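/- Let $\mathfrak{B}_{4,c}=V_4\rtimes(\mathfrak{Vir}\oplus\mathfrak{Vir})$ be the complex Lie algebra with basis $l_m,\ \bar l_m,\ T_{pq}$ $(m,p,q\in\mathbb{Z})$, $c_l,\ c_{\bar l}$ and brackets $$[l_m,l_n]=(m-n)\,l_{m+n}+\frac{c_l}{12}(m^3-m)\,\delta_{m+n,0},\qquad [\bar l_m,\bar l_n]=(m-n)\,\bar l_{m+n}+\frac{c_{\bar l}}{12}(m^3-m)\,\delta_{m+n,0},$$ $$[l_m,T_{pq}]=\Big(\frac{m+1}{2}-p\Big)T_{m+p,q},\qquad [\bar l_m,T_{pq}]=\Big(\frac{m+1}{2}-q\Big)T_{p,q+m},\qquad [T_{mn},T_{pq}]=[l_m,\bar l_n]=0,$$ with $c_l,c_{\bar l}$ central. Let $H^1(\mathfrak{B}_{4,c},\bigwedge^2\mathfrak{B}_{4,c})$ be the first Chevalley–Eilenberg cohomology group, with $\mathfrak{B}_{4,c}$ acting on $\bigwedge^2\mathfrak{B}_{4,c}$ by $x\triangleright(a\wedge b)=[x,a]\wedge b+a\wedge[x,b]$: the linear maps $\delta:\mathfrak{B}_{4,c}\to\bigwedge^2\mathfrak{B}_{4,c}$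 with $\delta([x,y])=x\triangleright\delta(y)-y\triangleright\delta(x)$, modulo the maps $x\mapsto x\triangleright r$ with $r\in\bigwedge^2\mathfrak{B}_{4,c}$. For independent parameters $\alpha,\bar\alpha\in\mathbb{C}$ let $\delta_{\alpha,\bar\alpha}:\mathfrak{B}_{4,c}\to\bigwedge^2\mathfrak{B}_{4,c}$ be the linear map $$l_m\mapsto 0,\qquad \bar l_m\mapsto 0,\qquad c_l\mapsto 0,\qquad c_{\bar l}\mapsto 0,\qquad T_{pq}\mapsto(\alpha c_l+\bar\alpha c_{\bar l})\wedge T_{pq}.$$ Then every $\delta_{\alpha,\bar\alpha}$ is a 1-cocycle, every class in $H^1(\mathfrak{B}_{4,c},\bigwedge^2\mathfrak{B}_{4,c})$ is the class of some $\delta_{\alpha,\bar\alpha}$, and the pair $(\alpha,\bar\alpha)\in\mathbb{C}^2$ is uniquely determined by the class; in particular $\delta_{\alpha,\bar\alpha}$ is not a coboundary unless $\alpha=\bar\alpha=0$. -/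

import Mathlib

open scoped exteriorPower

noncomputable section

/-! ### The second exterior power of a Lie module -/

namespace ExteriorSquare

section

theorem update_zero {M : Type*} (a b x : M) : Function.update ![a, b] 0 x = ![x, b] := by
  ext i
  fin_cases i <;> rfl

theorem update_one {M : Type*} (a b x : M) : Function.update ![a, b] 1 x = ![a, x] := by
  ext i
  fin_cases i <;> rfl

variable {R M : Type*} [CommRing R] [AddCommGroup M] [Module R M]

/-- The exterior square `⋀² M`. -/
def ExtSq (R M : Type*) [CommRing R] [AddCommGroup M] [Module R M] : Type _ := ⋀[R]^2 M

instance : AddCommGroup (ExtSq R M) := inferInstanceAs (AddCommGroup (⋀[R]^2 M))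
instance : Module R (ExtSq R M) := inferInstanceAs (Module R (⋀[R]^2 M))

/-- The wedge product `a ∧ b` in the second exterior power. -/
def wedge (a b : M) : ExtSq R M := exteriorPower.ιMulti R 2 ![a, b]

theorem wedge_add_left (a a' b : M) :
    wedge (R := R) (a + a') b = wedge a b + wedge a' b := by
  have h := (exteriorPower.ιMulti R 2 (M := M)).map_update_add ![a, b] 0 a a'
  simp only [update_zero] at h
  exact h

theorem wedge_add_right (a b b' : M) :
    wedge (R := R) a (b + b') = wedge a b + wedge a b' := by
  have h := (exteriorPower.ιMulti R 2 (M := M)).map_update_add ![a, b] 1 b b'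
  simp only [update_one] at h
  exact h

theorem wedge_smul_left (r : R) (a b : M) :
    wedge (R := R) (r • a) b = r • wedge a b := by
  have h := (exteriorPower.ιMulti R 2 (M := M)).map_update_smul ![a, b] 0 r a
  simp only [update_zero] at h
  exact h

theorem wedge_smul_right (r : R) (a b : M) :
    wedge (R := R) a (r • b) = r • wedge a b := by
  have h := (exteriorPower.ιMulti R 2 (M := M)).map_update_smul ![a, b] 1 r b
  simp only [update_one] at h
  exact h

theorem wedge_self (a : M) : wedge (R := R) a a = 0 :=
  (exteriorPower.ιMulti R 2 (M := M)).map_eq_zero_of_eq ![a, a] (i := 0) (j := 1)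
    (by simp) (by decide)

theorem wedge_swap (a b : M) : wedge (R := R) a b = - wedge b a := by
  have h := wedge_self (R := R) (a + b)
  rw [wedge_add_left, wedge_add_right, wedge_add_right, wedge_self, wedge_self] at h
  simp only [zero_add, add_zero] at h
  exact eq_neg_of_add_eq_zero_left h

/-- The alternating map `(a, b) ↦ f a ∧ b + a ∧ f b`. -/
def extendAlt (f : M →ₗ[R] M) : M [⋀^Fin 2]→ₗ[R] ExtSq R M where
  toFun v := wedge (f (v 0)) (v 1) + wedge (v 0) (f (v 1))
  map_update_add' := by
    intro inst v i x y
    have hi : inst = instDecidableEqFin 2 := Subsingleton.elim _ _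
    subst hi
    fin_cases i <;> simp [wedge_add_left, wedge_add_right] <;> abel
  map_update_smul' := by
    intro inst v i r x
    have hi : inst = instDecidableEqFin 2 := Subsingleton.elim _ _
    subst hi
    fin_cases i <;> simp [wedge_smul_left, wedge_smul_right]
  map_eq_zero_of_eq' := by
    intro v i j hv hij
    have h01 : v 0 = v 1 := by
      fin_cases i <;> fin_cases j <;> simp_all
    change wedge (f (v 0)) (v 1) + wedge (v 0) (f (v 1)) = 0
    rw [h01, wedge_swap (v 1) (f (v 1)), add_neg_cancel]

/-- The extension of an endomorphism `f` of `M` to the endomorphism of the exterior square with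
`a ∧ b ↦ f a ∧ b + a ∧ f b`. -/
def extend (f : M →ₗ[R] M) : ExtSq R M →ₗ[R] ExtSq R M :=
  exteriorPower.alternatingMapLinearEquiv (extendAlt f)

theorem extend_wedge (f : M →ₗ[R] M) (a b : M) :
    extend f (wedge a b) = wedge (f a) b + wedge a (f b) :=
  exteriorPower.alternatingMapLinearEquiv_apply_ιMulti (extendAlt f) ![a, b]

theorem hom_ext {N : Type*} [AddCommGroup N] [Module R N] {F G : ExtSq R M →ₗ[R] N}
    (h : ∀ a b : M, F (wedge a b) = G (wedge a b)) : F = G := by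
  apply exteriorPower.linearMap_ext
  ext v
  have hv : v = ![v 0, v 1] := by
    ext i
    fin_cases i <;> rfl
  have := h (v 0) (v 1)
  rw [wedge, ← hv] at this
  exact this

end

section

variable {R L M : Type*} [CommRing R] [LieRing L] [LieAlgebra R L]
  [AddCommGroup M] [Module R M] [LieRingModule L M] [LieModule R L M]

/-- The action of a Lie algebra on the exterior square of a module:
`x ▹ (a ∧ b) = (x ▹ a) ∧ b + a ∧ (x ▹ b)`. -/
instance instLieRingModule : LieRingModule L (ExtSq R M) where
  bracket x w := extend (LieModule.toEnd R L M x) w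
  add_lie x y w := by
    have : extend (LieModule.toEnd R L M (x + y)) =
        extend (LieModule.toEnd R L M x) + extend (LieModule.toEnd R L M y) :=
      hom_ext fun a b => by
        simp [extend_wedge, wedge_add_left, wedge_add_right]
        abel
    exact LinearMap.congr_fun this w
  lie_add x := map_add _
  leibniz_lie x y w := by
    have : extend (LieModule.toEnd R L M x) ∘ₗ extend (LieModule.toEnd R L M y) =
        extend (LieModule.toEnd R L M ⁅x, y⁆) +
          extend (LieModule.toEnd R L M y) ∘ₗ extend (LieModule.toEnd R L M x) :=
      hom_ext fun a b => by
        simp only [LinearMap.comp_apply, LinearMap.add_apply, extend_wedge, map_add,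
          LieModule.toEnd_apply_apply]
        rw [leibniz_lie x y a, leibniz_lie x y b, wedge_add_left, wedge_add_right]
        abel
    exact LinearMap.congr_fun this w

theorem lie_wedge (x : L) (a b : M) :
    ⁅x, wedge (R := R) a b⁆ = wedge ⁅x, a⁆ b + wedge a ⁅x, b⁆ :=
  extend_wedge _ a b

instance instLieModule : LieModule R L (ExtSq R M) where
  smul_lie t x w := by
    have : extend (LieModule.toEnd R L M (t • x)) = t • extend (LieModule.toEnd R L M x) :=
      hom_ext fun a b => by
        simp [extend_wedge, wedge_smul_left, wedge_smul_right]
    exact LinearMap.congr_fun this w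
  lie_smul t x w := map_smul (extend (LieModule.toEnd R L M x)) t w

end

end ExteriorSquare

/-! ### First Chevalley–Eilenberg cohomology -/

namespace LieCohomology

variable (R L M : Type*) [CommRing R] [LieRing L] [LieAlgebra R L]
  [AddCommGroup M] [Module R M] [LieRingModule L M] [LieModule R L M]

/-- The differential from 0-cochains to 1-cochains, `r ↦ (x ↦ x ▹ r)`. -/
def d₀₁ : M →ₗ[R] LieModule.Cohomology.oneCochain R L M :=
  (LieModule.toEnd R L M : L →ₗ[R] Module.End R M).flip

/-- The 1-cocycles: linear `f : L → M` with `f ⁅x, y⁆ = x ▹ f y - y ▹ f x`. -/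
def Z1 : Submodule R (LieModule.Cohomology.oneCochain R L M) :=
  LinearMap.ker (LieModule.Cohomology.d₁₂ R L M)

/-- The 1-coboundaries: the maps `x ↦ x ▹ r` with `r` in `M`. -/
def B1 : Submodule R (LieModule.Cohomology.oneCochain R L M) :=
  LinearMap.range (d₀₁ R L M)

theorem B1_le_Z1 : B1 R L M ≤ Z1 R L M := by
  rintro _ ⟨r, rfl⟩
  rw [Z1, LinearMap.mem_ker]
  ext x y
  change ⁅x, ⁅y, r⁆⁆ - ⁅y, ⁅x, r⁆⁆ - ⁅⁅x, y⁆, r⁆ = 0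
  rw [leibniz_lie x y r]
  abel

/-- The first cohomology group `H¹(L, M)`: 1-cocycles modulo 1-coboundaries. -/
abbrev H1 : Type _ := Z1 R L M ⧸ (B1 R L M).submoduleOf (Z1 R L M)

end LieCohomology

/-! ### The centrally extended BMS algebra in four dimensions -/

namespace BMS4c

/-- Labels of the basis of `𝔅_{4,c} = V₄ ⋊ (𝔙𝔦𝔯 ⊕ 𝔙𝔦𝔯)`. -/
inductive Gen : Type
  | l (m : ℤ)
  | lbar (m : ℤ)
  | T (p q : ℤ)
  | c
  | cbar

/-- The underlying complex vector space of `𝔅_{4,c}`, with basis `Gen`. -/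
def B4c : Type := Gen →₀ ℂ

instance : AddCommGroup B4c := inferInstanceAs (AddCommGroup (Gen →₀ ℂ))
instance : Module ℂ B4c := inferInstanceAs (Module ℂ (Gen →₀ ℂ))

/-- The basis of `𝔅_{4,c}` given by the generators. -/
def basis : Module.Basis Gen ℂ B4c := .ofRepr (LinearEquiv.refl ℂ (Gen →₀ ℂ))

/-- The superrotation generators `l_m`. -/
def l (m : ℤ) : B4c := basis (.l m)

/-- The superrotation generators `l̄_m`. -/
def lbar (m : ℤ) : B4c := basis (.lbar m)

/-- The supertranslation generators `T_{pq}`. -/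
def T (p q : ℤ) : B4c := basis (.T p q)

/-- The central element `c_l`. -/
def c : B4c := basis .c

/-- The central element `c_{l̄}`. -/
def cbar : B4c := basis .cbar

/-- The coefficient `(m³ - m) / 12 * δ_{m+n,0}` of the central term. -/
def central (m n : ℤ) : ℂ := if m + n = 0 then ((m : ℂ) ^ 3 - m) / 12 else 0

theorem central_skew (m n : ℤ) : central m n = -central n m := by
  unfold central
  rw [add_comm n m]
  split_ifs with h
  · obtain rfl : n = -m := by omega
    push_cast
    ring
  · simp

theorem central_cocycle (m n k : ℤ) :
    ((n : ℂ) - k) * central m (n + k) =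
      ((m : ℂ) - n) * central (m + n) k + ((m : ℂ) - k) * central n (m + k) := by
  unfold central
  by_cases h : m + n + k = 0
  · rw [if_pos (by omega), if_pos (by omega), if_pos (by omega)]
    obtain rfl : k = -m - n := by omega
    push_cast
    ring
  · rw [if_neg (by omega), if_neg (by omega), if_neg (by omega)]
    simp

/-- The brackets of the generators. -/
def genBracket : Gen → Gen → B4c
  | .l m, .l n =>
      ((m : ℂ) - n) • l (m + n) + central m n • c
  | .lbar m, .lbar n =>
      ((m : ℂ) - n) • lbar (m + n) + central m n • cbar
  | .l m, .T p q => (((m : ℂ) + 1) / 2 - p) • T (m + p) q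
  | .T p q, .l m => -((((m : ℂ) + 1) / 2 - p) • T (m + p) q)
  | .lbar m, .T p q => (((m : ℂ) + 1) / 2 - q) • T p (q + m)
  | .T p q, .lbar m => -((((m : ℂ) + 1) / 2 - q) • T p (q + m))
  | _, _ => 0

/-- The bracket of `𝔅_{4,c}` as a bilinear map. -/
def bracketHom : B4c →ₗ[ℂ] B4c →ₗ[ℂ] B4c :=
  basis.constr ℂ fun i => basis.constr ℂ fun j => genBracket i j

theorem bracketHom_basis (i j : Gen) : bracketHom (basis i) (basis j) = genBracket i j := by
  simp [bracketHom]

theorem bracketHom_skew (x y : B4c) : bracketHom x y = -bracketHom y x := by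
  have : bracketHom = -bracketHom.flip := by
    refine basis.ext fun i => basis.ext fun j => ?_
    simp only [LinearMap.neg_apply, LinearMap.flip_apply, bracketHom_basis]
    cases i <;> cases j <;> simp only [genBracket, neg_zero, neg_neg]
    all_goals
      rename_i m n
      rw [add_comm n m, neg_add, ← neg_smul, ← neg_smul, neg_sub, central_skew n m, neg_neg]
  exact LinearMap.congr_fun₂ this x y

theorem bracketHom_leibniz_basis (i j k : Gen) :
    bracketHom (basis i) (bracketHom (basis j) (basis k)) =
      bracketHom (bracketHom (basis i) (basis j)) (basis k) +
        bracketHom (basis j) (bracketHom (basis i) (basis k)) := by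
  cases i <;> cases j <;> cases k <;>
    simp only [bracketHom_basis, genBracket, l, lbar, T, c, cbar, map_add, map_smul, map_neg,
      map_zero, LinearMap.add_apply, LinearMap.smul_apply, LinearMap.neg_apply,
      LinearMap.zero_apply, smul_zero, add_zero, neg_zero, zero_add]
  case l.l.l m n k =>
    have h := central_cocycle m n k
    rw [← add_assoc m n k, ← add_assoc n m k, add_comm n m]
    push_cast
    linear_combination (norm := module) h • basis Gen.c
  case lbar.lbar.lbar m n k =>
    have h := central_cocycle m n k
    rw [← add_assoc m n k, ← add_assoc n m k, add_comm n m]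
    push_cast
    linear_combination (norm := module) h • basis Gen.cbar
  all_goals
    try simp only [add_comm, add_left_comm]
    push_cast
    module

theorem bracketHom_leibniz (x y z : B4c) :
    bracketHom x (bracketHom y z) =
      bracketHom (bracketHom x y) z + bracketHom y (bracketHom x z) := by
  have hx : x ∈ Submodule.span ℂ (Set.range basis) := basis.mem_span x
  have hy : y ∈ Submodule.span ℂ (Set.range basis) := basis.mem_span y
  have hz : z ∈ Submodule.span ℂ (Set.range basis) := basis.mem_span z
  induction hx using Submodule.span_induction with
  | zero => simp
  | add a b _ _ ha hb => simp only [map_add, LinearMap.add_apply, ha, hb]; abel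
  | smul t a _ ha => simp only [map_smul, LinearMap.smul_apply, ha, smul_add]
  | mem a ha =>
    obtain ⟨i, rfl⟩ := ha
    induction hy using Submodule.span_induction with
    | zero => simp
    | add a b _ _ ha hb => simp only [map_add, LinearMap.add_apply, ha, hb]; abel
    | smul t a _ ha => simp only [map_smul, LinearMap.smul_apply, ha, smul_add]
    | mem a ha =>
      obtain ⟨j, rfl⟩ := ha
      induction hz using Submodule.span_induction with
      | zero => simp
      | add a b _ _ ha hb => simp only [map_add, ha, hb]; abel
      | smul t a _ ha => simp only [map_smul, ha, smul_add]
      | mem a ha =>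
        obtain ⟨k, rfl⟩ := ha
        exact bracketHom_leibniz_basis i j k

instance : LieRing B4c where
  bracket x y := bracketHom x y
  add_lie x y z := by
    change bracketHom (x + y) z = _
    rw [map_add]
    rfl
  lie_add x y z := map_add (bracketHom x) y z
  lie_self x := by
    have h := bracketHom_skew x x
    have h2 : (2 : ℂ) • bracketHom x x = 0 := by
      rw [two_smul]
      exact add_eq_zero_iff_eq_neg.mpr h
    exact (smul_eq_zero.mp h2).resolve_left two_ne_zero
  leibniz_lie := bracketHom_leibniz

instance : LieAlgebra ℂ B4c where
  lie_smul t x y := map_smul (bracketHom x) t y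

theorem lie_basis (i j : Gen) : ⁅basis i, basis j⁆ = genBracket i j := bracketHom_basis i j

/-- The values of `δ_{α,ᾱ}` on the generators. -/
def deltaGen (α αbar : ℂ) : Gen → ExteriorSquare.ExtSq ℂ B4c
  | .T p q => ExteriorSquare.wedge (α • c + αbar • cbar) (T p q)
  | _ => 0

/-- The linear map `δ_{α,ᾱ}` with `T_{pq} ↦ (α c_l + ᾱ c_{l̄}) ∧ T_{pq}`, vanishing on
`l_m`, `l̄_m`, `c_l` and `c_{l̄}`. -/
def delta (α αbar : ℂ) : B4c →ₗ[ℂ] ExteriorSquare.ExtSq ℂ B4c :=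
  basis.constr ℂ (deltaGen α αbar)

end BMS4c

end

/-! Two mechanisms drive the computation: inner semisimple elements force cocycles to be
homogeneous, and the commuting supertranslations leave little room for what remains.

The element `gradingElt = l_0 + i l̄_0` acts diagonally, and since `1` and `i` are linearly
independent over the reals its eigenvalue records the whole bidegree. Modulo a coboundary a cocycle
commutes with it (`exists_homogeneous`), so weights decide which components can occur. The weight of
`T_{pq}` is half-odd in both directions, while the other generators have integral weights. Hence
`f(T_{pq})` consists of terms `T ∧ l_a`, `T ∧ l̄_a` and `T_{pq} ∧ central`.

Because `[T, T'] = 0`, `T ▹ f(T') = T' ▹ f(T)`. For `a ≠ 0` this separates variables and identifies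
the `T ∧ l_a` terms with the coboundary of `½ ∑ μ_a l_a ∧ l_{-a}`, likewise with bars (`cf_T_l_eq`,
`cf_T_lbar_eq`). For `a = 0` it says that a pairing of half-odd lattice points is antisymmetric,
hence a multiple of the determinant, which is the coboundary of a multiple of `l_0 ∧ l̄_0`
(`eq_mul_of_antisymm`). The central terms become independent of `(p, q)` after subtracting the
coboundary of `l_0 ∧ central + l̄_0 ∧ central` (`cf_T_central_const`); the two constants are `α` and
`ᾱ` up to sign.

A homogeneous cocycle vanishing on all `T` takes values on `l_m` and `l̄_m` that are combinations of
`T ∧ T'` (`translationPart_of_lie_T_eq_zero`). There `l_2` and `l̄_2` commute, act injectively, and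
`l̄_2` remains injective modulo the image of `l_2`; so `f(l_2) = l_2 ▹ r` (`exists_lie_l_eq`), and
subtracting the coboundary of `r` kills everything else.

For uniqueness, the coefficient of `T_{pq} ∧ c` in `T_{pq} ▹ r` is odd under reflection of `(p, q)`
in `(1/2, 1/2)`, whereas in `δ_{α,ᾱ}` it is constant (`delta_eq_d₀₁`). -/

noncomputable section

/-! ### Coordinates on the exterior square -/

namespace ExteriorSquare

variable {R M N : Type*} [CommRing R] [AddCommGroup M] [Module R M] [AddCommGroup N] [Module R N]

/-- The linear map on the exterior square induced by a bilinear map vanishing on the diagonal. -/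
def lift (B : M →ₗ[R] M →ₗ[R] N) (hB : ∀ a, B a a = 0) : ExtSq R M →ₗ[R] N :=
  exteriorPower.alternatingMapLinearEquiv
    { toFun := fun v => B (v 0) (v 1)
      map_update_add' := by
        intro inst v i x y
        have hi : inst = instDecidableEqFin 2 := Subsingleton.elim _ _
        subst hi
        fin_cases i <;> simp
      map_update_smul' := by
        intro inst v i r x
        have hi : inst = instDecidableEqFin 2 := Subsingleton.elim _ _
        subst hi
        fin_cases i <;> simp
      map_eq_zero_of_eq' := by
        intro v i j hv hij
        have h01 : v 0 = v 1 := by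
          fin_cases i <;> fin_cases j <;> simp_all
        change B (v 0) (v 1) = 0
        rw [h01, hB] }

theorem lift_wedge (B : M →ₗ[R] M →ₗ[R] N) (hB : ∀ a, B a a = 0) (a b : M) :
    lift B hB (wedge a b) = B a b :=
  exteriorPower.alternatingMapLinearEquiv_apply_ιMulti _ ![a, b]

/-- The wedge product as a bilinear map. -/
def wedgeHom : M →ₗ[R] M →ₗ[R] ExtSq R M :=
  LinearMap.mk₂ R wedge wedge_add_left wedge_smul_left wedge_add_right
    (fun r a b => wedge_smul_right r a b)

theorem wedgeHom_apply (a b : M) : wedgeHom (R := R) a b = wedge a b := rfl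

theorem hom_ext_basis {ι : Type*} (e : Module.Basis ι R M) {F G : ExtSq R M →ₗ[R] N}
    (h : ∀ i j, F (wedge (e i) (e j)) = G (wedge (e i) (e j))) : F = G := by
  refine hom_ext fun a b => ?_
  have : wedgeHom.compr₂ F = (wedgeHom (R := R) (M := M)).compr₂ G :=
    e.ext fun i => e.ext fun j => by simpa [wedgeHom_apply] using h i j
  exact LinearMap.congr_fun₂ this a b

/-- The pairing of `a ∧ b` with `ξ ∧ η`, equal to `ξ a * η b - η a * ξ b`. -/
def pair (ξ η : Module.Dual R M) : ExtSq R M →ₗ[R] R :=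
  lift (LinearMap.mk₂ R (fun a b => ξ a * η b - η a * ξ b)
    (fun a a' b => by simp only [map_add]; ring) (fun r a b => by simp; ring)
    (fun a b b' => by simp only [map_add]; ring) (fun r a b => by simp; ring))
    (fun a => by simp [mul_comm])

theorem pair_wedge (ξ η : Module.Dual R M) (a b : M) :
    pair ξ η (wedge a b) = ξ a * η b - η a * ξ b := lift_wedge _ _ a b

theorem pair_swap (ξ η : Module.Dual R M) (w : ExtSq R M) : pair ξ η w = -pair η ξ w := by
  have : pair ξ η = -pair η ξ := hom_ext fun a b => by simp [pair_wedge]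
  exact LinearMap.congr_fun this w

theorem pair_add_left (ξ ξ' η : Module.Dual R M) (w : ExtSq R M) :
    pair (ξ + ξ') η w = pair ξ η w + pair ξ' η w := by
  have : pair (ξ + ξ') η = pair ξ η + pair ξ' η := hom_ext fun a b => by
    simp [pair_wedge]; ring
  exact LinearMap.congr_fun this w

theorem pair_smul_left (t : R) (ξ η : Module.Dual R M) (w : ExtSq R M) :
    pair (t • ξ) η w = t * pair ξ η w := by
  have : pair (t • ξ) η = t • pair ξ η := hom_ext fun a b => by
    simp [pair_wedge]; ring
  exact LinearMap.congr_fun this w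

theorem pair_add_right (ξ η η' : Module.Dual R M) (w : ExtSq R M) :
    pair ξ (η + η') w = pair ξ η w + pair ξ η' w := by
  rw [pair_swap, pair_add_left, pair_swap ξ η, pair_swap ξ η', neg_add]

theorem pair_smul_right (t : R) (ξ η : Module.Dual R M) (w : ExtSq R M) :
    pair ξ (t • η) w = t * pair ξ η w := by
  rw [pair_swap, pair_smul_left, pair_swap ξ η, mul_neg]

theorem pair_zero_left (η : Module.Dual R M) (w : ExtSq R M) : pair 0 η w = 0 := by
  simpa using pair_smul_left 0 0 η w

theorem pair_zero_right (η : Module.Dual R M) (w : ExtSq R M) : pair η 0 w = 0 := by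
  simpa using pair_smul_right 0 η 0 w

theorem pair_self (ξ : Module.Dual R M) (w : ExtSq R M) : pair ξ ξ w = 0 := by
  have : pair ξ ξ = 0 := hom_ext fun a b => by simp [pair_wedge]
  exact LinearMap.congr_fun this w

/-- The action is by derivations, so it transposes onto the two functionals; every coefficient of `x
▹ w` thus reduces to a coadjoint computation. -/
theorem pair_lie {L : Type*} [LieRing L] [LieAlgebra R L] [LieRingModule L M] [LieModule R L M]
    (ξ η : Module.Dual R M) (x : L) (w : ExtSq R M) :
    pair ξ η ⁅x, w⁆ = pair (ξ ∘ₗ LieModule.toEnd R L M x) η w +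
      pair ξ (η ∘ₗ LieModule.toEnd R L M x) w := by
  have : pair ξ η ∘ₗ LieModule.toEnd R L (ExtSq R M) x =
      pair (ξ ∘ₗ LieModule.toEnd R L M x) η + pair ξ (η ∘ₗ LieModule.toEnd R L M x) :=
    hom_ext fun a b => by
      simp only [LinearMap.comp_apply, LieModule.toEnd_apply_apply, lie_wedge, map_add,
        pair_wedge, LinearMap.add_apply]
      ring
  exact LinearMap.congr_fun this w

section Coordinates

variable {ι : Type*} (e : Module.Basis ι R M)

/-- The coefficients of `a ⊗ b`. -/
def tensorCoeffs : M →ₗ[R] M →ₗ[R] (ι × ι →₀ R) :=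
  e.constr R fun i => e.constr R fun j => Finsupp.single (i, j) (1 : R)

/-- The antisymmetric coefficient matrix of an element of the exterior square. -/
def coeffs : ExtSq R M →ₗ[R] (ι × ι →₀ R) :=
  lift (LinearMap.mk₂ R (fun a b => tensorCoeffs e a b - tensorCoeffs e b a)
    (fun a a' b => by simp only [map_add, LinearMap.add_apply]; abel)
    (fun r a b => by simp only [map_smul, LinearMap.smul_apply, smul_sub])
    (fun a b b' => by simp only [map_add, LinearMap.add_apply]; abel)
    (fun r a b => by simp only [map_smul, LinearMap.smul_apply, smul_sub]))
    (fun a => by simp)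

theorem coeffs_basis (i j : ι) :
    coeffs e (wedge (e i) (e j)) = Finsupp.single (i, j) (1 : R) - Finsupp.single (j, i) 1 := by
  simp [coeffs, lift_wedge, tensorCoeffs]

theorem coeffs_apply (w : ExtSq R M) (i j : ι) :
    coeffs e w (i, j) = pair (e.coord i) (e.coord j) w := by
  classical
  have : Finsupp.lapply (i, j) ∘ₗ coeffs e = pair (e.coord i) (e.coord j) :=
    hom_ext_basis e fun k m => by
      simp only [LinearMap.comp_apply, coeffs_basis, pair_wedge, Finsupp.lapply_apply,
        Module.Basis.coord_apply, Module.Basis.repr_self, Finsupp.sub_apply,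
        Finsupp.single_apply, Prod.mk.injEq]
      congr 1
      · by_cases h1 : k = i <;> by_cases h2 : m = j <;> simp [h1, h2]
      · by_cases h1 : k = j <;> by_cases h2 : m = i <;> simp [h1, h2]
  exact LinearMap.congr_fun this w

theorem finite_pair_ne_zero (w : ExtSq R M) :
    {p : ι × ι | pair (e.coord p.1) (e.coord p.2) w ≠ 0}.Finite := by
  refine (coeffs e w).hasFiniteSupport.subset fun p hp => ?_
  simpa [Function.mem_support, ← coeffs_apply] using hp

/-- The element of the exterior square with the given, not necessarily antisymmetric,
coefficients. -/
def ofCoeffs : (ι × ι →₀ R) →ₗ[R] ExtSq R M :=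
  Finsupp.linearCombination R fun p => wedge (e p.1) (e p.2)

/-- Each basis bivector enters the antisymmetric matrix twice, at `(i, j)` and `(j, i)`, with
opposite signs absorbed by `wedge_swap`. -/
theorem ofCoeffs_coeffs (w : ExtSq R M) : ofCoeffs e (coeffs e w) = (2 : R) • w := by
  have : ofCoeffs e ∘ₗ coeffs e = (2 : R) • LinearMap.id := hom_ext_basis e fun i j => by
    simp only [LinearMap.comp_apply, coeffs_basis, map_sub, ofCoeffs,
      Finsupp.linearCombination_single, LinearMap.smul_apply, LinearMap.id_apply, one_smul]
    rw [wedge_swap (e j) (e i), two_smul, sub_neg_eq_add]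
  exact LinearMap.congr_fun this w

theorem pair_ofCoeffs (F : ι × ι →₀ R) (i j : ι) :
    pair (e.coord i) (e.coord j) (ofCoeffs e F) = F (i, j) - F (j, i) := by
  classical
  have : pair (e.coord i) (e.coord j) ∘ₗ ofCoeffs e =
      Finsupp.lapply (i, j) - Finsupp.lapply (j, i) := by
    ext ⟨k, m⟩
    simp only [LinearMap.comp_apply, ofCoeffs, Finsupp.lsingle_apply,
      Finsupp.linearCombination_single, one_smul, ← coeffs_apply, coeffs_basis,
      LinearMap.sub_apply, Finsupp.lapply_apply, Finsupp.sub_apply, Finsupp.single_apply,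
      Prod.mk.injEq]
    simp only [and_comm]
  exact LinearMap.congr_fun this F

end Coordinates

section Field

variable {K V ι : Type*} [Field K] [CharZero K] [AddCommGroup V] [Module K V]
  (e : Module.Basis ι K V)

theorem ext_pair {w w' : ExtSq K V}
    (h : ∀ i j, pair (e.coord i) (e.coord j) w = pair (e.coord i) (e.coord j) w') : w = w' := by
  have h2 : coeffs e w = coeffs e w' := by
    ext ⟨i, j⟩
    rw [coeffs_apply, coeffs_apply, h]
  have h3 := ofCoeffs_coeffs e w
  rw [h2, ofCoeffs_coeffs] at h3
  exact (smul_right_injective _ (two_ne_zero (α := K)) h3).symm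

theorem exists_pair_eq (F : ι → ι → K) (hF : ∀ i j, F i j = -F j i)
    (hfin : {p : ι × ι | F p.1 p.2 ≠ 0}.Finite) :
    ∃ w : ExtSq K V, ∀ i j, pair (e.coord i) (e.coord j) w = F i j := by
  let G : ι × ι →₀ K := Finsupp.ofSupportFinite (fun p => F p.1 p.2) hfin
  refine ⟨(2⁻¹ : K) • ofCoeffs e G, fun i j => ?_⟩
  rw [map_smul, pair_ofCoeffs]
  change (2⁻¹ : K) * (F i j - F j i) = F i j
  rw [hF j i]
  ring

end Field

end ExteriorSquare

/-! ### The cocycle condition on elements -/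

namespace LieCohomology

variable {R L M : Type*} [CommRing R] [LieRing L] [LieAlgebra R L]
  [AddCommGroup M] [Module R M] [LieRingModule L M] [LieModule R L M]

theorem mem_Z1_iff {f : LieModule.Cohomology.oneCochain R L M} :
    f ∈ Z1 R L M ↔ ∀ x y : L, f ⁅x, y⁆ = ⁅x, f y⁆ - ⁅y, f x⁆ := by
  rw [Z1, LinearMap.mem_ker]
  constructor
  · intro h x y
    have h1 := LieModule.Cohomology.d₁₂_apply_apply R L M f x y
    rw [h] at h1
    exact (sub_eq_zero.mp h1.symm).symm
  · intro h
    ext x y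
    change ⁅x, f y⁆ - ⁅y, f x⁆ - f ⁅x, y⁆ = 0
    rw [h x y, sub_self]

theorem d₀₁_apply (r : M) (x : L) : d₀₁ R L M r x = ⁅x, r⁆ := rfl

theorem d₀₁_mem_Z1 (r : M) : d₀₁ R L M r ∈ Z1 R L M := B1_le_Z1 R L M ⟨r, rfl⟩

end LieCohomology

/-! ### Coefficients and the coadjoint action -/

namespace BMS4c

open ExteriorSquare LieCohomology

/-- The exterior square of `𝔅_{4,c}`. -/
abbrev Wedge2 : Type := ExtSq ℂ B4c

/-- The coefficient of `i ∧ j` in an element of the exterior square. -/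
def cf (i j : Gen) : Wedge2 →ₗ[ℂ] ℂ := pair (basis.coord i) (basis.coord j)

theorem cf_swap (i j : Gen) (w : Wedge2) : cf i j w = -cf j i w := pair_swap _ _ w

theorem cf_self (i : Gen) (w : Wedge2) : cf i i w = 0 := pair_self _ w

theorem cf_ext {w w' : Wedge2} (h : ∀ i j, cf i j w = cf i j w') : w = w' :=
  ext_pair basis h

theorem finite_cf_ne_zero (w : Wedge2) : {p : Gen × Gen | cf p.1 p.2 w ≠ 0}.Finite :=
  finite_pair_ne_zero basis w

theorem exists_cf_eq (F : Gen → Gen → ℂ) (hF : ∀ i j, F i j = -F j i)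
    (hfin : {p : Gen × Gen | F p.1 p.2 ≠ 0}.Finite) : ∃ w : Wedge2, ∀ i j, cf i j w = F i j :=
  exists_pair_eq basis F hF hfin

/-- The coadjoint action on the coordinate functionals, `i ↦ i ∘ ad x`. -/
def coad (x : B4c) (i : Gen) : Module.Dual ℂ B4c :=
  basis.coord i ∘ₗ LieModule.toEnd ℂ B4c B4c x

theorem cf_lie (x : B4c) (i j : Gen) (w : Wedge2) :
    cf i j ⁅x, w⁆ = pair (coad x i) (basis.coord j) w + pair (basis.coord i) (coad x j) w :=
  pair_lie _ _ x w

theorem lie_l_l (m n : ℤ) : ⁅l m, l n⁆ = ((m : ℂ) - n) • l (m + n) + central m n • c :=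
  lie_basis _ _

theorem lie_lbar_lbar (m n : ℤ) :
    ⁅lbar m, lbar n⁆ = ((m : ℂ) - n) • lbar (m + n) + central m n • cbar :=
  lie_basis _ _

theorem lie_l_lbar (m n : ℤ) : ⁅l m, lbar n⁆ = 0 := lie_basis _ _

theorem lie_l_T (m p q : ℤ) : ⁅l m, T p q⁆ = (((m : ℂ) + 1) / 2 - p) • T (m + p) q :=
  lie_basis _ _

theorem lie_lbar_T (m p q : ℤ) : ⁅lbar m, T p q⁆ = (((m : ℂ) + 1) / 2 - q) • T p (q + m) :=
  lie_basis _ _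

theorem lie_T_T (p q r s : ℤ) : ⁅T p q, T r s⁆ = 0 := lie_basis _ _

theorem lie_c (x : B4c) : ⁅c, x⁆ = 0 := by
  have : bracketHom c = 0 := basis.ext fun j => by
    rw [c, bracketHom_basis]; cases j <;> rfl
  exact LinearMap.congr_fun this x

theorem lie_cbar (x : B4c) : ⁅cbar, x⁆ = 0 := by
  have : bracketHom cbar = 0 := basis.ext fun j => by
    rw [cbar, bracketHom_basis]; cases j <;> rfl
  exact LinearMap.congr_fun this x

section

set_option linter.unusedSimpArgs false

theorem coad_apply_basis (i j k : Gen) :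
    coad (basis i) k (basis j) = basis.repr (genBracket i j) k := by
  rw [← lie_basis]; rfl

theorem coad_l_l (m a : ℤ) :
    coad (l m) (.l a) = (2 * (m : ℂ) - a) • basis.coord (.l (a - m)) := by
  classical
  refine basis.ext fun j => ?_
  rw [l, coad_apply_basis]
  cases j <;> simp [genBracket, l, lbar, T, c, cbar, Finsupp.single_apply]
  rename_i n
  by_cases h : m + n = a
  · subst h
    simp
    ring
  · rw [if_neg h, if_neg h, if_neg (by omega), sub_zero]

theorem coad_l_lbar (m a : ℤ) : coad (l m) (.lbar a) = 0 := by
  classical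
  refine basis.ext fun j => ?_
  rw [l, coad_apply_basis]
  cases j <;> simp [genBracket, l, lbar, T, c, cbar, Finsupp.single_apply]

theorem coad_l_T (m p q : ℤ) :
    coad (l m) (.T p q) = (((m : ℂ) + 1) / 2 - (p - m)) • basis.coord (.T (p - m) q) := by
  classical
  refine basis.ext fun j => ?_
  rw [l, coad_apply_basis]
  cases j <;> simp [genBracket, l, lbar, T, c, cbar, Finsupp.single_apply]
  rename_i r s
  by_cases h : m + r = p ∧ s = q
  · obtain ⟨rfl, rfl⟩ := h
    simp
  · rw [if_neg h, if_neg h, if_neg (by omega), sub_zero]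

theorem coad_l_c (m : ℤ) : coad (l m) .c = central m (-m) • basis.coord (.l (-m)) := by
  classical
  refine basis.ext fun j => ?_
  rw [l, coad_apply_basis]
  cases j <;> simp [genBracket, l, lbar, T, c, cbar, Finsupp.single_apply, central]
  rename_i n
  simp only [add_eq_zero_iff_eq_neg']
  split_ifs <;> simp

theorem coad_l_cbar (m : ℤ) : coad (l m) .cbar = 0 := by
  classical
  refine basis.ext fun j => ?_
  rw [l, coad_apply_basis]
  cases j <;> simp [genBracket, l, lbar, T, c, cbar, Finsupp.single_apply]

theorem coad_lbar_lbar (m a : ℤ) :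
    coad (lbar m) (.lbar a) = (2 * (m : ℂ) - a) • basis.coord (.lbar (a - m)) := by
  classical
  refine basis.ext fun j => ?_
  rw [lbar, coad_apply_basis]
  cases j <;> simp [genBracket, l, lbar, T, c, cbar, Finsupp.single_apply]
  rename_i n
  by_cases h : m + n = a
  · subst h
    simp
    ring
  · rw [if_neg h, if_neg h, if_neg (by omega), sub_zero]

theorem coad_lbar_l (m a : ℤ) : coad (lbar m) (.l a) = 0 := by
  classical
  refine basis.ext fun j => ?_
  rw [lbar, coad_apply_basis]
  cases j <;> simp [genBracket, l, lbar, T, c, cbar, Finsupp.single_apply]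

theorem coad_lbar_T (m p q : ℤ) :
    coad (lbar m) (.T p q) = (((m : ℂ) + 1) / 2 - (q - m)) • basis.coord (.T p (q - m)) := by
  classical
  refine basis.ext fun j => ?_
  rw [lbar, coad_apply_basis]
  cases j <;> simp [genBracket, l, lbar, T, c, cbar, Finsupp.single_apply]
  rename_i r s
  by_cases h : r = p ∧ s + m = q
  · obtain ⟨rfl, rfl⟩ := h
    simp
  · rw [if_neg h, if_neg h, if_neg (by omega), sub_zero]

theorem coad_lbar_cbar (m : ℤ) :
    coad (lbar m) .cbar = central m (-m) • basis.coord (.lbar (-m)) := by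
  classical
  refine basis.ext fun j => ?_
  rw [lbar, coad_apply_basis]
  cases j <;> simp [genBracket, l, lbar, T, c, cbar, Finsupp.single_apply, central]
  rename_i n
  simp only [add_eq_zero_iff_eq_neg']
  split_ifs <;> simp

theorem coad_lbar_c (m : ℤ) : coad (lbar m) .c = 0 := by
  classical
  refine basis.ext fun j => ?_
  rw [lbar, coad_apply_basis]
  cases j <;> simp [genBracket, l, lbar, T, c, cbar, Finsupp.single_apply]

theorem coad_T_l (p q a : ℤ) : coad (T p q) (.l a) = 0 := by
  classical
  refine basis.ext fun j => ?_
  rw [T, coad_apply_basis]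
  cases j <;> simp [genBracket, l, lbar, T, c, cbar, Finsupp.single_apply]

theorem coad_T_lbar (p q a : ℤ) : coad (T p q) (.lbar a) = 0 := by
  classical
  refine basis.ext fun j => ?_
  rw [T, coad_apply_basis]
  cases j <;> simp [genBracket, l, lbar, T, c, cbar, Finsupp.single_apply]

theorem coad_T_c (p q : ℤ) : coad (T p q) .c = 0 := by
  classical
  refine basis.ext fun j => ?_
  rw [T, coad_apply_basis]
  cases j <;> simp [genBracket, l, lbar, T, c, cbar, Finsupp.single_apply]

theorem coad_T_cbar (p q : ℤ) : coad (T p q) .cbar = 0 := by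
  classical
  refine basis.ext fun j => ?_
  rw [T, coad_apply_basis]
  cases j <;> simp [genBracket, l, lbar, T, c, cbar, Finsupp.single_apply]

/-- `T_{uv}` arises from `[T_{pq}, ·]` in two ways: from `l_{u-p}` within a row and from `l̄_{v-q}`
within a column. Both occur when the two labels agree. -/
theorem coad_T_T (p q u v : ℤ) :
    coad (T p q) (.T u v) =
      (if v = q then (p - ((u : ℂ) - p + 1) / 2) else 0) • basis.coord (.l (u - p)) +
      (if u = p then (q - ((v : ℂ) - q + 1) / 2) else 0) • basis.coord (.lbar (v - q)) := by
  classical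
  refine basis.ext fun j => ?_
  rw [T, coad_apply_basis]
  by_cases hv : v = q <;> by_cases hu : u = p <;> cases j <;>
    simp [genBracket, l, lbar, T, Finsupp.single_apply, hu, hv, eq_sub_iff_add_eq, add_comm]
  all_goals
    split_ifs with h
    · subst h
      push_cast
      ring
    · ring

end

theorem pair_coord (i j : Gen) (w : Wedge2) :
    pair (basis.coord i) (basis.coord j) w = cf i j w := rfl

/-! ### The grading -/

/-- A grading element, whose adjoint action has zero eigenvalue only in bidegree `(0, 0)`. -/
def gradingElt : B4c := l 0 + Complex.I • lbar 0

/-- The eigenvalues of `ad gradingElt` on the generators. -/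
def weight : Gen → ℂ
  | .l m => -(m : ℂ)
  | .lbar m => -(m : ℂ) * Complex.I
  | .T p q => (1 / 2 - (p : ℂ)) + (1 / 2 - (q : ℂ)) * Complex.I
  | _ => 0

theorem gradingElt_lie_basis (i : Gen) : ⁅gradingElt, basis i⁆ = weight i • basis i := by
  rw [gradingElt, add_lie, smul_lie, l, lbar, lie_basis, lie_basis]
  cases i <;> simp [genBracket, weight, l, lbar, T, c, cbar, central]
  all_goals module

theorem coad_gradingElt (i : Gen) : coad gradingElt i = weight i • basis.coord i := by
  classical
  refine basis.ext fun j => ?_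
  change basis.coord i ⁅gradingElt, basis j⁆ = _
  rw [gradingElt_lie_basis]
  by_cases h : j = i
  · subst h; simp
  · simp [h]

theorem cf_gradingElt_lie (i j : Gen) (w : Wedge2) :
    cf i j ⁅gradingElt, w⁆ = (weight i + weight j) * cf i j w := by
  rw [cf_lie, coad_gradingElt, coad_gradingElt, pair_smul_left, pair_smul_right, pair_coord]
  ring

/-- Cochains commuting with the grading element. -/
def Homogeneous (f : B4c →ₗ[ℂ] Wedge2) : Prop := ∀ x, f ⁅gradingElt, x⁆ = ⁅gradingElt, f x⁆

theorem Homogeneous.cf_eq_zero {f : B4c →ₗ[ℂ] Wedge2} (hf : Homogeneous f) {k i j : Gen}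
    (h : weight i + weight j ≠ weight k) : cf i j (f (basis k)) = 0 := by
  have h1 := congrArg (cf i j) (hf (basis k))
  rw [gradingElt_lie_basis, map_smul, map_smul, cf_gradingElt_lie, smul_eq_mul] at h1
  have h2 : (weight i + weight j - weight k) * cf i j (f (basis k)) = 0 := by
    rw [sub_mul, h1, sub_self]
  exact (mul_eq_zero.mp h2).resolve_left (sub_ne_zero.mpr h)

theorem Homogeneous.sub_d₀₁ {f : B4c →ₗ[ℂ] Wedge2} (hf : Homogeneous f) {r : Wedge2}
    (hr : ⁅gradingElt, r⁆ = 0) : Homogeneous (f - d₀₁ ℂ B4c Wedge2 r) := by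
  intro x
  rw [LinearMap.sub_apply, LinearMap.sub_apply, hf x, d₀₁_apply, d₀₁_apply, lie_sub,
    leibniz_lie, hr, lie_zero, add_zero]

/-- Once `f(gradingElt)` has weight zero, the cocycle identity at a generator of weight `λ` equates
a bivector of weight `λ` with one in the image of `gradingElt - λ`; diagonalizability makes both
vanish. -/
theorem exists_homogeneous {f : B4c →ₗ[ℂ] Wedge2} (hf : f ∈ Z1 ℂ B4c Wedge2) :
    ∃ r, Homogeneous (f - d₀₁ ℂ B4c Wedge2 r) := by
  -- `r` inverts `gradingElt` on the nonzero-weight part of `f gradingElt`; in weight zero the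
  -- quotient takes the default value 0.
  obtain ⟨r, hr⟩ := exists_cf_eq (fun i j => cf i j (f gradingElt) / (weight i + weight j))
    (fun i j => by rw [cf_swap i j, add_comm, neg_div])
    ((finite_cf_ne_zero (f gradingElt)).subset fun p hp h => hp (by simp [h]))
  refine ⟨r, ?_⟩
  set g := f - d₀₁ ℂ B4c Wedge2 r with hg
  have hgZ : g ∈ Z1 ℂ B4c Wedge2 := sub_mem hf (d₀₁_mem_Z1 r)
  rw [mem_Z1_iff] at hgZ
  have hg0 : ⁅gradingElt, g gradingElt⁆ = 0 := by
    refine cf_ext fun i j => ?_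
    rw [cf_gradingElt_lie, hg, LinearMap.sub_apply, d₀₁_apply, map_sub, cf_gradingElt_lie, hr,
      map_zero]
    by_cases h : weight i + weight j = 0
    · simp [h]
    · field_simp
      simp
  have key : ∀ k, ⁅basis k, g gradingElt⁆ = 0 := by
    intro k
    have h1 := hgZ gradingElt (basis k)
    have h2 : ⁅gradingElt, ⁅basis k, g gradingElt⁆⁆ = weight k • ⁅basis k, g gradingElt⁆ := by
      rw [leibniz_lie, hg0, lie_zero, add_zero, gradingElt_lie_basis, smul_lie]
    refine cf_ext fun i j => ?_
    have h3 := congrArg (cf i j) h2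
    have h4 := congrArg (cf i j) h1
    rw [gradingElt_lie_basis] at h4
    simp only [cf_gradingElt_lie, map_smul, map_sub, smul_eq_mul, map_zero] at h3 h4 ⊢
    have h5 : (weight i + weight j - weight k) * cf i j ⁅basis k, g gradingElt⁆ = 0 := by
      linear_combination h3
    rcases mul_eq_zero.mp h5 with h6 | h6
    · linear_combination h4 + cf i j (g (basis k)) * h6
    · exact h6
  intro x
  have h0 : d₀₁ ℂ B4c Wedge2 (g gradingElt) = 0 := basis.ext fun k => key k
  have h2 : ⁅x, g gradingElt⁆ = 0 := LinearMap.congr_fun h0 x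
  rw [hgZ, h2, sub_zero]

/-! ### The cocycles `δ_{α,ᾱ}` -/

theorem delta_basis (α αbar : ℂ) (i : Gen) : delta α αbar (basis i) = deltaGen α αbar i := by
  simp [delta]

theorem delta_T (α αbar : ℂ) (p q : ℤ) :
    delta α αbar (T p q) = wedge (α • c + αbar • cbar) (T p q) := delta_basis _ _ _

theorem lie_central (x : B4c) (α αbar : ℂ) : ⁅x, α • c + αbar • cbar⁆ = 0 := by
  rw [← lie_skew, add_lie, smul_lie, smul_lie, lie_c, lie_cbar]
  simp

/-- The `T`-degree (1 on each `T_{pq}`, 0 on the other generators) is a derivation, and wedging with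
a central element commutes with the action. -/
theorem delta_mem_Z1 (α αbar : ℂ) : delta α αbar ∈ Z1 ℂ B4c Wedge2 := by
  rw [mem_Z1_iff]
  have hc (x b : B4c) : ⁅x, wedge (R := ℂ) (α • c + αbar • cbar) b⁆ =
      wedge (α • c + αbar • cbar) ⁅x, b⁆ := by
    rw [lie_wedge, lie_central]
    simpa using wedge_smul_left (0 : ℂ) 0 b
  let B₁ : B4c →ₗ[ℂ] B4c →ₗ[ℂ] Wedge2 := bracketHom.compr₂ (delta α αbar)
  let B₂ : B4c →ₗ[ℂ] B4c →ₗ[ℂ] Wedge2 :=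
    (LieModule.toEnd ℂ B4c Wedge2 : B4c →ₗ[ℂ] Module.End ℂ Wedge2).compl₂ (delta α αbar)
  have h : B₁ = B₂ - B₂.flip := by
    refine basis.ext fun i => basis.ext fun j => ?_
    change delta α αbar ⁅basis i, basis j⁆ =
      ⁅basis i, delta α αbar (basis j)⁆ - ⁅basis j, delta α αbar (basis i)⁆
    rw [delta_basis, delta_basis, lie_basis]
    have hl (m : ℤ) : delta α αbar (l m) = 0 := delta_basis _ _ _
    have hlbar (m : ℤ) : delta α αbar (lbar m) = 0 := delta_basis _ _ _
    have h_c : delta α αbar c = 0 := delta_basis _ _ _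
    have h_cbar : delta α αbar cbar = 0 := delta_basis _ _ _
    have hwz (a : B4c) : wedge (R := ℂ) a 0 = 0 := by simpa using wedge_smul_right (0 : ℂ) a 0
    cases i <;> cases j <;>
      simp only [deltaGen, genBracket, lie_zero, sub_zero, map_add, map_smul, map_neg, map_zero,
        hl, hlbar, h_c, h_cbar, delta_T, hc, smul_zero, add_zero, zero_sub, sub_self]
    all_goals
      simp only [T, lie_basis, genBracket, hwz, neg_zero, sub_self, wedge_smul_right]
  intro x y
  exact LinearMap.congr_fun₂ h x y

/-- The coefficient of `c` in `T_{pq} ▹ r`. -/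
theorem cf_T_c_lie_T (p q : ℤ) (w : Wedge2) :
    cf (.T p q) .c ⁅T p q, w⁆ =
      (p - 1 / 2) * cf (.l 0) .c w + (q - 1 / 2) * cf (.lbar 0) .c w := by
  simp only [cf_lie, coad_T_T, coad_T_c, pair_add_left, pair_smul_left, pair_zero_right,
    pair_coord, sub_self, if_true]
  ring

theorem cf_T_cbar_lie_T (p q : ℤ) (w : Wedge2) :
    cf (.T p q) .cbar ⁅T p q, w⁆ =
      (p - 1 / 2) * cf (.l 0) .cbar w + (q - 1 / 2) * cf (.lbar 0) .cbar w := by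
  simp only [cf_lie, coad_T_T, coad_T_cbar, pair_add_left, pair_smul_left, pair_zero_right,
    pair_coord, sub_self, if_true]
  ring

theorem cf_delta_T (α αbar : ℂ) (p q : ℤ) (i j : Gen) :
    cf i j (delta α αbar (T p q)) =
      (α * basis.coord i c + αbar * basis.coord i cbar) * basis.coord j (T p q) -
      (α * basis.coord j c + αbar * basis.coord j cbar) * basis.coord i (T p q) := by
  rw [delta_T, cf, pair_wedge]
  simp only [map_add, map_smul, smul_eq_mul]

/-- At `(0, 0)` and `(1, 1)` the coboundary coefficients are opposite, while `delta` contributes the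
same value at both. -/
theorem delta_eq_d₀₁ {α αbar : ℂ} {r : Wedge2} (h : delta α αbar = d₀₁ ℂ B4c Wedge2 r) :
    α = 0 ∧ αbar = 0 := by
  have h1 (p q : ℤ) : delta α αbar (T p q) = ⁅T p q, r⁆ := LinearMap.congr_fun h _
  have h2 (p q : ℤ) := congrArg (cf (.T p q) .c) (h1 p q)
  have h3 (p q : ℤ) := congrArg (cf (.T p q) .cbar) (h1 p q)
  simp only [cf_T_c_lie_T, cf_T_cbar_lie_T, cf_delta_T] at h2 h3
  simp [c, cbar, T] at h2 h3
  have a := h2 0 0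
  have b := h2 1 1
  have a' := h3 0 0
  have b' := h3 1 1
  push_cast at a b a' b'
  exact ⟨by linear_combination (-1/2) * a - 1/2 * b, by linear_combination (-1/2) * a' - 1/2 * b'⟩

/-! ### The values of a homogeneous cocycle on the supertranslations -/

theorem cf_T_T_lie_T (p q u v u' v' : ℤ) (w : Wedge2) :
    cf (.T u v) (.T u' v') ⁅T p q, w⁆ =
      (if v = q then (p - ((u : ℂ) - p + 1) / 2) else 0) * cf (.l (u - p)) (.T u' v') w +
      (if u = p then (q - ((v : ℂ) - q + 1) / 2) else 0) * cf (.lbar (v - q)) (.T u' v') w +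
      ((if v' = q then (p - ((u' : ℂ) - p + 1) / 2) else 0) * cf (.T u v) (.l (u' - p)) w +
      (if u' = p then (q - ((v' : ℂ) - q + 1) / 2) else 0) * cf (.T u v) (.lbar (v' - q)) w) := by
  simp only [cf_lie, coad_T_T, pair_add_left, pair_smul_left, pair_add_right, pair_smul_right,
    pair_coord]

theorem cf_T_lie_T (p q u v : ℤ) (j : Gen) (w : Wedge2) (hj : ∀ u v, j ≠ .T u v) :
    cf (.T u v) j ⁅T p q, w⁆ =
      (if v = q then (p - ((u : ℂ) - p + 1) / 2) else 0) * cf (.l (u - p)) j w +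
      (if u = p then (q - ((v : ℂ) - q + 1) / 2) else 0) * cf (.lbar (v - q)) j w := by
  cases j
  case T u v => exact absurd rfl (hj u v)
  all_goals
    simp only [cf_lie, coad_T_T, coad_T_l, coad_T_lbar, coad_T_c, coad_T_cbar, pair_zero_right,
      pair_add_left, pair_smul_left, pair_coord, add_zero]

theorem lie_T_comm {f : B4c →ₗ[ℂ] Wedge2} (hf : f ∈ Z1 ℂ B4c Wedge2) (p q r s : ℤ) :
    ⁅T p q, f (T r s)⁆ = ⁅T r s, f (T p q)⁆ := by
  have h := mem_Z1_iff.mp hf (T p q) (T r s)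
  rw [lie_T_T, map_zero] at h
  exact sub_eq_zero.mp h.symm

/-- Compare coefficients of `T_{p-a,q} ∧ T_{r+a,s}` in `lie_T_comm`; the inequalities leave one
surviving term on each side. -/
theorem cf_T_l_relation {f : B4c →ₗ[ℂ] Wedge2} (hf : f ∈ Z1 ℂ B4c Wedge2) {p q r s a : ℤ}
    (ha : a ≠ 0) (hpr : p ≠ r) (hqs : q ≠ s) (hapr : a ≠ p - r) :
    (((a : ℂ) + 1) / 2 - r) * cf (.T (p - a) q) (.l a) (f (T p q)) =
      -((1 - (a : ℂ)) / 2 - p) * cf (.T (r + a) s) (.l (-a)) (f (T r s)) := by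
  have h := congrArg (cf (.T (p - a) q) (.T (r + a) s)) (lie_T_comm hf p q r s)
  rw [cf_T_T_lie_T, cf_T_T_lie_T, if_pos rfl, if_neg (by omega), if_neg (by omega),
    if_neg (by omega), if_neg (by omega), if_neg (by omega), if_pos rfl, if_neg (by omega),
    sub_sub_cancel_left, add_sub_cancel_left, cf_swap (.l (-a))] at h
  push_cast at h
  linear_combination h

theorem cf_T_lbar_relation {f : B4c →ₗ[ℂ] Wedge2} (hf : f ∈ Z1 ℂ B4c Wedge2) {p q r s a : ℤ}
    (ha : a ≠ 0) (hpr : p ≠ r) (hqs : q ≠ s) (haqs : a ≠ q - s) :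
    (((a : ℂ) + 1) / 2 - s) * cf (.T p (q - a)) (.lbar a) (f (T p q)) =
      -((1 - (a : ℂ)) / 2 - q) * cf (.T r (s + a)) (.lbar (-a)) (f (T r s)) := by
  have h := congrArg (cf (.T p (q - a)) (.T r (s + a))) (lie_T_comm hf p q r s)
  rw [cf_T_T_lie_T, cf_T_T_lie_T, if_neg (by omega), if_pos rfl, if_neg (by omega),
    if_neg (by omega), if_neg (by omega), if_neg (by omega), if_neg (by omega), if_pos rfl,
    sub_sub_cancel_left, add_sub_cancel_left, cf_swap (.lbar (-a))] at h
  push_cast at h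
  linear_combination h

/-- The coefficients of `l_a ∧ l_{-a}` in the bivector whose coboundary has the same
`T ∧ l_a`-components on supertranslations as `f`. -/
def correctionL (f : B4c →ₗ[ℂ] Wedge2) (a : ℤ) : ℂ :=
  if a = 0 then 0 else
    cf (.T (0 - a) 0) (.l a) (f (T 0 0)) - cf (.T (1 - a) 0) (.l a) (f (T 1 0))

/-- The coefficients of `l̄_a ∧ l̄_{-a}` in the bivector whose coboundary has the same
`T ∧ l̄_a`-components on supertranslations as `f`. -/
def correctionLbar (f : B4c →ₗ[ℂ] Wedge2) (a : ℤ) : ℂ :=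
  if a = 0 then 0 else
    cf (.T 0 (0 - a)) (.lbar a) (f (T 0 0)) - cf (.T 0 (1 - a)) (.lbar a) (f (T 0 1))

/-- Supplies an auxiliary index in general position with respect to `p`, `0` and `1` at once, with a
cancellable factor. -/
theorem exists_int_avoid (a p : ℤ) :
    ∃ r : ℤ, r ≠ p ∧ r ≠ 0 ∧ r ≠ 1 ∧ a ≠ p - r ∧ a ≠ 0 - r ∧ a ≠ 1 - r ∧
      ((a : ℂ) + 1) / 2 - r ≠ 0 := by
  refine ⟨|a| + |p| + 3, ?_, ?_, ?_, ?_, ?_, ?_, ?_⟩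
  any_goals grind
  intro h
  have h2 : ((a + 1 - 2 * (|a| + |p| + 3) : ℤ) : ℂ) = 0 := by
    push_cast at h ⊢
    linear_combination 2 * h
  have h3 := Int.cast_eq_zero.mp h2
  grind

/-- With the auxiliary `(r, s)` fixed, `cf_T_l_relation` makes the coefficient proportional to `(1 -
a)/2 - p`. This factor has slope `-1` in `p`, so the difference of the values at `p = 0` and `p = 1`
is exactly the constant of proportionality. -/
theorem cf_T_l_eq {f : B4c →ₗ[ℂ] Wedge2} (hf : f ∈ Z1 ℂ B4c Wedge2) (p q : ℤ) {a : ℤ}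
    (ha : a ≠ 0) :
    cf (.T (p - a) q) (.l a) (f (T p q)) = correctionL f a * ((1 - (a : ℂ)) / 2 - p) := by
  obtain ⟨r, h1, h2, h3, h4, h5, h6, h7⟩ := exists_int_avoid a p
  have hs : ∃ s : ℤ, s ≠ q ∧ s ≠ 0 := ⟨|q| + 1, by grind, by grind⟩
  obtain ⟨s, hs1, hs2⟩ := hs
  have e1 := cf_T_l_relation hf ha h1.symm hs1.symm h4
  have e2 := cf_T_l_relation hf (p := 0) ha h2.symm hs2.symm h5
  have e3 := cf_T_l_relation hf (p := 1) ha h3.symm hs2.symm h6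
  rw [correctionL, if_neg ha]
  apply mul_left_cancel₀ h7
  push_cast at e2 e3
  linear_combination e1 - ((1 - (a : ℂ)) / 2 - p) * (e2 - e3)

theorem cf_T_lbar_eq {f : B4c →ₗ[ℂ] Wedge2} (hf : f ∈ Z1 ℂ B4c Wedge2) (p q : ℤ) {a : ℤ}
    (ha : a ≠ 0) :
    cf (.T p (q - a)) (.lbar a) (f (T p q)) = correctionLbar f a * ((1 - (a : ℂ)) / 2 - q) := by
  obtain ⟨s, h1, h2, h3, h4, h5, h6, h7⟩ := exists_int_avoid a q
  have hr : ∃ r : ℤ, r ≠ p ∧ r ≠ 0 := ⟨|p| + 1, by grind, by grind⟩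
  obtain ⟨r, hr1, hr2⟩ := hr
  have e1 := cf_T_lbar_relation hf ha hr1.symm h1.symm h4
  have e2 := cf_T_lbar_relation hf (q := 0) ha hr2.symm h2.symm h5
  have e3 := cf_T_lbar_relation hf (q := 1) ha hr2.symm h3.symm h6
  rw [correctionLbar, if_neg ha]
  apply mul_left_cancel₀ h7
  push_cast at e2 e3
  linear_combination e1 - ((1 - (a : ℂ)) / 2 - q) * (e2 - e3)

theorem exists_generic_pair (a : ℤ) :
    ∃ p r : ℤ, p ≠ r ∧ a ≠ p - r ∧ ((a : ℂ) + 1) / 2 - r ≠ 0 ∧ (1 - (a : ℂ)) / 2 - p ≠ 0 := by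
  obtain ⟨p, -, -, -, -, -, -, hp⟩ := exists_int_avoid (-a) 0
  obtain ⟨r, h1, -, -, h2, -, -, hr⟩ := exists_int_avoid a p
  refine ⟨p, r, h1.symm, h2, hr, ?_⟩
  push_cast at hp
  convert hp using 3
  ring

/-- Inserting `cf_T_l_eq` on both sides of `cf_T_l_relation` produces the same nonzero product of
factors. Oddness is what makes these numbers the matrix of a bivector. -/
theorem correctionL_neg {f : B4c →ₗ[ℂ] Wedge2} (hf : f ∈ Z1 ℂ B4c Wedge2) (a : ℤ) :
    correctionL f (-a) = -correctionL f a := by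
  by_cases ha : a = 0
  · simp [correctionL, ha]
  obtain ⟨p, r, h1, h2, h3, h4⟩ := exists_generic_pair a
  have e := cf_T_l_relation hf (q := 0) (s := 1) ha h1 (by norm_num) h2
  have e2 := cf_T_l_eq hf r 1 (neg_ne_zero.mpr ha)
  rw [cf_T_l_eq hf p 0 ha] at e
  rw [sub_neg_eq_add] at e2
  rw [e2] at e
  push_cast at e
  apply mul_left_cancel₀ (mul_ne_zero h3 h4)
  linear_combination e

theorem correctionLbar_neg {f : B4c →ₗ[ℂ] Wedge2} (hf : f ∈ Z1 ℂ B4c Wedge2) (a : ℤ) :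
    correctionLbar f (-a) = -correctionLbar f a := by
  by_cases ha : a = 0
  · simp [correctionLbar, ha]
  obtain ⟨q, s, h1, h2, h3, h4⟩ := exists_generic_pair a
  have e := cf_T_lbar_relation hf (p := 0) (r := 1) ha (by norm_num) h1 h2
  have e2 := cf_T_lbar_eq hf 1 s (neg_ne_zero.mpr ha)
  rw [cf_T_lbar_eq hf 0 q ha] at e
  rw [sub_neg_eq_add] at e2
  rw [e2] at e
  push_cast at e
  apply mul_left_cancel₀ (mul_ne_zero h3 h4)
  linear_combination e

theorem finite_cf_ne_zero_comp {ι : Type*} (g : ι → Gen × Gen) (hg : Function.Injective g)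
    (w : Wedge2) : {a : ι | cf (g a).1 (g a).2 w ≠ 0}.Finite :=
  (finite_cf_ne_zero w).preimage hg.injOn

theorem finite_correctionL (f : B4c →ₗ[ℂ] Wedge2) : {a | correctionL f a ≠ 0}.Finite := by
  have h0 := finite_cf_ne_zero_comp (fun a : ℤ => (.T (0 - a) 0, .l a))
    (fun a b h => by simpa using h) (f (T 0 0))
  have h1 := finite_cf_ne_zero_comp (fun a : ℤ => (.T (1 - a) 0, .l a))
    (fun a b h => by simpa using h) (f (T 1 0))
  refine (h0.union h1).subset fun a ha => ?_
  by_contra h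
  simp only [Set.mem_union, Set.mem_ofPred_eq, not_or, not_not] at h
  exact ha (by simp only [correctionL, h.1, h.2, sub_self, ite_self])

theorem finite_correctionLbar (f : B4c →ₗ[ℂ] Wedge2) : {a | correctionLbar f a ≠ 0}.Finite := by
  have h0 := finite_cf_ne_zero_comp (fun a : ℤ => (.T 0 (0 - a), .lbar a))
    (fun a b h => by simpa using h) (f (T 0 0))
  have h1 := finite_cf_ne_zero_comp (fun a : ℤ => (.T 0 (1 - a), .lbar a))
    (fun a b h => by simpa using h) (f (T 0 1))
  refine (h0.union h1).subset fun a ha => ?_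
  by_contra h
  simp only [Set.mem_union, Set.mem_ofPred_eq, not_or, not_not] at h
  exact ha (by simp only [correctionLbar, h.1, h.2, sub_self, ite_self])

/-- The coefficient matrix of `½ ∑ μ a l_a ∧ l_{-a} + ½ ∑ ν a l̄_a ∧ l̄_{-a} + ξ l_0 ∧ l̄_0`. -/
def virMatrix (μ ν : ℤ → ℂ) (ξ : ℂ) : Gen → Gen → ℂ
  | .l a, .l b => if a + b = 0 then μ a else 0
  | .lbar a, .lbar b => if a + b = 0 then ν a else 0
  | .l a, .lbar b => if a = 0 ∧ b = 0 then ξ else 0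
  | .lbar a, .l b => if a = 0 ∧ b = 0 then -ξ else 0
  | _, _ => 0

/-- Every term `l_a ∧ l_{-a}`, `l̄_a ∧ l̄_{-a}`, `l_0 ∧ l̄_0` has weight zero, so subtracting the
coboundary preserves homogeneity. -/
theorem exists_cf_eq_virMatrix {μ ν : ℤ → ℂ} (hμ : ∀ a, μ (-a) = -μ a)
    (hν : ∀ a, ν (-a) = -ν a) (hμf : {a | μ a ≠ 0}.Finite) (hνf : {a | ν a ≠ 0}.Finite) (ξ : ℂ) :
    ∃ r : Wedge2, (∀ i j, cf i j r = virMatrix μ ν ξ i j) ∧ ⁅gradingElt, r⁆ = 0 := by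
  obtain ⟨r, hr⟩ := exists_cf_eq (virMatrix μ ν ξ) (by
      intro i j
      cases i <;> cases j <;> simp only [virMatrix, neg_zero]
      case l.l a b =>
        rw [add_comm b a]
        split_ifs with h
        · obtain rfl : b = -a := by omega
          rw [hμ, neg_neg]
        · rw [neg_zero]
      case lbar.lbar a b =>
        rw [add_comm b a]
        split_ifs with h
        · obtain rfl : b = -a := by omega
          rw [hν, neg_neg]
        · rw [neg_zero]
      case l.lbar a b => simp only [and_comm]; split_ifs <;> simp
      case lbar.l a b => simp only [and_comm]; split_ifs <;> simp)
    (by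
      refine (((hμf.image fun a => (Gen.l a, Gen.l (-a))).union
        (hνf.image fun a => (Gen.lbar a, Gen.lbar (-a)))).union
        (Set.toFinite {(Gen.l 0, Gen.lbar 0), (Gen.lbar 0, Gen.l 0)})).subset ?_
      rintro ⟨i, j⟩ h
      cases i <;> cases j <;> simp [virMatrix] at h ⊢
      · exact ⟨h.2, by omega⟩
      · exact ⟨h.1, h.2.1⟩
      · exact ⟨h.1, h.2.1⟩
      · exact ⟨h.2, by omega⟩)
  refine ⟨r, hr, cf_ext fun i j => ?_⟩
  rw [cf_gradingElt_lie, hr, map_zero]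
  cases i <;> cases j <;> simp only [virMatrix, weight, mul_zero]
  case l.l a b =>
    split_ifs with h
    · obtain rfl : b = -a := by omega
      push_cast
      ring
    · ring
  case lbar.lbar a b =>
    split_ifs with h
    · obtain rfl : b = -a := by omega
      push_cast
      ring
    · ring
  case l.lbar a b =>
    split_ifs with h
    · simp [h.1, h.2]
    · ring
  case lbar.l a b =>
    split_ifs with h
    · simp [h.1, h.2]
    · ring

theorem exists_sub_offDiagonal {f : B4c →ₗ[ℂ] Wedge2} (hf : f ∈ Z1 ℂ B4c Wedge2)
    (hh : Homogeneous f) :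
    ∃ r, Homogeneous (f - d₀₁ ℂ B4c Wedge2 r) ∧
      (∀ p q a, a ≠ 0 → cf (.T (p - a) q) (.l a) ((f - d₀₁ ℂ B4c Wedge2 r) (T p q)) = 0) ∧
      (∀ p q a, a ≠ 0 → cf (.T p (q - a)) (.lbar a) ((f - d₀₁ ℂ B4c Wedge2 r) (T p q)) = 0) := by
  -- The `l_0 ∧ l̄_0` coefficient is 0 here: it only influences the components with `a = 0`, which
  -- are treated separately.
  obtain ⟨r, hr, hr0⟩ := exists_cf_eq_virMatrix (correctionL_neg hf) (correctionLbar_neg hf)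
    (finite_correctionL f) (finite_correctionLbar f) 0
  refine ⟨r, hh.sub_d₀₁ hr0, fun p q a ha => ?_, fun p q a ha => ?_⟩
  · rw [LinearMap.sub_apply, map_sub, cf_T_l_eq hf p q ha, d₀₁_apply,
      cf_T_lie_T _ _ _ _ _ _ (by simp), hr, hr, if_pos rfl, if_neg (by omega),
      sub_sub_cancel_left]
    simp only [virMatrix, neg_add_cancel, if_true, correctionL_neg hf]
    push_cast
    ring
  · rw [LinearMap.sub_apply, map_sub, cf_T_lbar_eq hf p q ha, d₀₁_apply,
      cf_T_lie_T _ _ _ _ _ _ (by simp), hr, hr, if_neg (by omega), if_pos rfl,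
      sub_sub_cancel_left]
    simp only [virMatrix, neg_add_cancel, if_true, correctionLbar_neg hf]
    push_cast
    ring

/-- Splits one complex weight equation into two integral ones, doubled so that parity can exclude
cases. -/
theorem half_int_add_I_eq_zero {x y : ℤ} (h : (x : ℂ) / 2 + (y : ℂ) / 2 * Complex.I = 0) :
    x = 0 ∧ y = 0 := by
  rw [Complex.ext_iff] at h
  simpa using h

/-- The generators other than `c_l` and `c_{l̄}`. -/
def Noncentral (i : Gen) : Prop := i ≠ .c ∧ i ≠ .cbar

theorem weight_add_eq_weight_T {i j : Gen} (hi : Noncentral i) (hj : Noncentral j) {p q : ℤ}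
    (h : weight i + weight j = weight (.T p q)) :
    (∃ a, i = .T (p - a) q ∧ j = .l a) ∨ (∃ a, i = .T p (q - a) ∧ j = .lbar a) ∨
      (∃ a, j = .T (p - a) q ∧ i = .l a) ∨ (∃ a, j = .T p (q - a) ∧ i = .lbar a) := by
  cases i <;> cases j <;> simp only [weight] at h
  case c.c | c.cbar | c.l | c.lbar | c.T => exact absurd rfl hi.1
  case cbar.c | cbar.cbar | cbar.l | cbar.lbar | cbar.T => exact absurd rfl hi.2
  case l.c | lbar.c | T.c => exact absurd rfl hj.1
  case l.cbar | lbar.cbar | T.cbar => exact absurd rfl hj.2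
  case l.l a b =>
    have := half_int_add_I_eq_zero (x := -2 * a - 2 * b - 1 + 2 * p) (y := 2 * q - 1)
      (by push_cast; linear_combination h)
    omega
  case l.lbar a b =>
    have := half_int_add_I_eq_zero (x := -2 * a - 1 + 2 * p) (y := 2 * q - 1 - 2 * b)
      (by push_cast; linear_combination h)
    omega
  case lbar.l a b =>
    have := half_int_add_I_eq_zero (x := -2 * b - 1 + 2 * p) (y := 2 * q - 1 - 2 * a)
      (by push_cast; linear_combination h)
    omega
  case lbar.lbar a b =>
    have := half_int_add_I_eq_zero (x := -1 + 2 * p) (y := 2 * q - 1 - 2 * a - 2 * b)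
      (by push_cast; linear_combination h)
    omega
  case T.T u v u' v' =>
    have := half_int_add_I_eq_zero (x := 1 - 2 * u - 2 * u' + 2 * p)
      (y := 1 - 2 * v - 2 * v' + 2 * q) (by push_cast; linear_combination h)
    omega
  case T.l u v a =>
    have := half_int_add_I_eq_zero (x := 2 * p - 2 * u - 2 * a) (y := 2 * q - 2 * v)
      (by push_cast; linear_combination h)
    obtain rfl : u = p - a := by omega
    obtain rfl : v = q := by omega
    exact Or.inl ⟨a, rfl, rfl⟩
  case T.lbar u v a =>
    have := half_int_add_I_eq_zero (x := 2 * p - 2 * u) (y := 2 * q - 2 * v - 2 * a)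
      (by push_cast; linear_combination h)
    obtain rfl : u = p := by omega
    obtain rfl : v = q - a := by omega
    exact Or.inr (Or.inl ⟨a, rfl, rfl⟩)
  case l.T a u v =>
    have := half_int_add_I_eq_zero (x := 2 * p - 2 * u - 2 * a) (y := 2 * q - 2 * v)
      (by push_cast; linear_combination h)
    obtain rfl : u = p - a := by omega
    obtain rfl : v = q := by omega
    exact Or.inr (Or.inr (Or.inl ⟨a, rfl, rfl⟩))
  case lbar.T a u v =>
    have := half_int_add_I_eq_zero (x := 2 * p - 2 * u) (y := 2 * q - 2 * v - 2 * a)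
      (by push_cast; linear_combination h)
    obtain rfl : u = p := by omega
    obtain rfl : v = q - a := by omega
    exact Or.inr (Or.inr (Or.inr ⟨a, rfl, rfl⟩))

/-- This is the coefficient of `T_{pq} ∧ T_{rs}` in `lie_T_comm`. Extra contributions arise only
when the two points share a row or column, and those are off-diagonal components, already zero. -/
theorem diagonal_relation {f : B4c →ₗ[ℂ] Wedge2} (hf : f ∈ Z1 ℂ B4c Wedge2)
    (h1 : ∀ p q a, a ≠ 0 → cf (.T (p - a) q) (.l a) (f (T p q)) = 0)
    (h2 : ∀ p q a, a ≠ 0 → cf (.T p (q - a)) (.lbar a) (f (T p q)) = 0)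
    {p q r s : ℤ} (hne : ¬ (p = r ∧ q = s)) :
    (1 / 2 - (r : ℂ)) * cf (.T p q) (.l 0) (f (T p q)) +
      (1 / 2 - (s : ℂ)) * cf (.T p q) (.lbar 0) (f (T p q)) =
    -((1 / 2 - (p : ℂ)) * cf (.T r s) (.l 0) (f (T r s)) +
      (1 / 2 - (q : ℂ)) * cf (.T r s) (.lbar 0) (f (T r s))) := by
  have hL (p q r s : ℤ) (hne : ¬ (p = r ∧ q = s)) (t : ℂ) :
      (if s = q then t else 0) * cf (.T p q) (.l (r - p)) (f (T r s)) = 0 := by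
    split_ifs with h
    · subst h
      have := h1 r s (r - p) (by omega)
      rw [sub_sub_cancel] at this
      rw [this, mul_zero]
    · rw [zero_mul]
  have hR (p q r s : ℤ) (hne : ¬ (p = r ∧ q = s)) (t : ℂ) :
      (if r = p then t else 0) * cf (.T p q) (.lbar (s - q)) (f (T r s)) = 0 := by
    split_ifs with h
    · subst h
      have := h2 r s (s - q) (by omega)
      rw [sub_sub_cancel] at this
      rw [this, mul_zero]
    · rw [zero_mul]
  have h := congrArg (cf (.T p q) (.T r s)) (lie_T_comm hf p q r s)
  rw [cf_T_T_lie_T, cf_T_T_lie_T, hL p q r s hne, hR p q r s hne, cf_swap (.l (p - r)),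
    cf_swap (.lbar (q - s)), mul_neg, mul_neg, hL r s p q (by omega), hR r s p q (by omega),
    if_pos rfl, if_pos rfl, if_pos rfl, if_pos rfl] at h
  simp only [sub_self] at h
  rw [cf_swap (.l 0), cf_swap (.lbar 0)] at h
  linear_combination h

/-- An antisymmetric pairing of distinct half-odd lattice points, linear in one argument,
is a multiple of the determinant. -/
theorem eq_mul_of_antisymm {X Y : ℤ → ℤ → ℂ}
    (h : ∀ p q r s : ℤ, ¬ (p = r ∧ q = s) →
      (1 / 2 - (r : ℂ)) * X p q + (1 / 2 - (s : ℂ)) * Y p q =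
        -((1 / 2 - (p : ℂ)) * X r s + (1 / 2 - (q : ℂ)) * Y r s)) :
    ∃ ξ : ℂ, ∀ p q : ℤ, X p q = ξ * (1 / 2 - q) ∧ Y p q = -ξ * (1 / 2 - p) := by
  -- On coinciding points the relation would give `X 0 0 + Y 0 0 = 0` and `X 0 1 = Y 0 1`
  -- immediately; as it is unavailable there, they are extracted from samples at distinct points.
  have a1 := h 0 0 0 1 (by norm_num)
  have a2 := h 2 0 0 0 (by norm_num)
  have a3 := h 2 0 0 1 (by norm_num)
  have a4 := h 0 2 0 0 (by norm_num)
  have a5 := h 0 2 0 1 (by norm_num)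
  have a6 := h 2 2 0 0 (by norm_num)
  have a7 := h 2 2 0 1 (by norm_num)
  have a8 := h 2 0 0 2 (by norm_num)
  have a9 := h 2 0 2 2 (by norm_num)
  have a10 := h 0 2 2 2 (by norm_num)
  push_cast at *
  have e1 : Y 0 0 = -X 0 0 := by grind
  have e2 : X 0 1 = -X 0 0 := by grind
  have e3 : Y 0 1 = -X 0 0 := by grind
  refine ⟨2 * X 0 0, fun p q => ?_⟩
  by_cases h0 : p = 0 ∧ q = 0
  · obtain ⟨rfl, rfl⟩ := h0
    push_cast
    exact ⟨by ring, by rw [e1]; ring⟩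
  by_cases h1 : p = 0 ∧ q = 1
  · obtain ⟨rfl, rfl⟩ := h1
    push_cast
    exact ⟨by rw [e2]; ring, by rw [e3]; ring⟩
  -- Pairing with the points `(0, 0)` and `(0, 1)`, that is with the independent vectors `(1/2,
  -- 1/2)` and `(1/2, -1/2)`, determines `X p q` and `Y p q`.
  have b1 := h p q 0 0 h0
  have b2 := h p q 0 1 h1
  rw [e1] at b1
  rw [e2, e3] at b2
  push_cast at b1 b2
  exact ⟨by linear_combination b1 + b2, by linear_combination b1 - b2⟩

theorem exists_sub_noncentral {f : B4c →ₗ[ℂ] Wedge2} (hf : f ∈ Z1 ℂ B4c Wedge2)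
    (hh : Homogeneous f) :
    ∃ r, Homogeneous (f - d₀₁ ℂ B4c Wedge2 r) ∧
      ∀ p q i j, Noncentral i → Noncentral j →
        cf i j ((f - d₀₁ ℂ B4c Wedge2 r) (T p q)) = 0 := by
  obtain ⟨r₁, hg, h1, h2⟩ := exists_sub_offDiagonal hf hh
  have hgZ := sub_mem hf (d₀₁_mem_Z1 r₁)
  set g := f - d₀₁ ℂ B4c Wedge2 r₁ with hgdef
  obtain ⟨ξ, hξ⟩ := eq_mul_of_antisymm
    (X := fun p q => cf (.T p q) (.l 0) (g (T p q)))
    (Y := fun p q => cf (.T p q) (.lbar 0) (g (T p q)))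
    (fun p q r s hne => diagonal_relation hgZ h1 h2 hne)
  obtain ⟨r₂, hr, hr0⟩ := exists_cf_eq_virMatrix (μ := fun _ => 0) (ν := fun _ => 0)
    (fun _ => neg_zero.symm) (fun _ => neg_zero.symm) (by simp) (by simp) ξ
  have hgr : f - d₀₁ ℂ B4c Wedge2 (r₁ + r₂) = g - d₀₁ ℂ B4c Wedge2 r₂ := by
    rw [map_add, hgdef, sub_sub]
  refine ⟨r₁ + r₂, ?_⟩
  rw [hgr]
  have hk := hg.sub_d₀₁ hr0
  refine ⟨hk, fun p q i j hi hj => ?_⟩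
  have hl (a : ℤ) : cf (.T (p - a) q) (.l a) ((g - d₀₁ ℂ B4c Wedge2 r₂) (T p q)) = 0 := by
    rw [LinearMap.sub_apply, map_sub, d₀₁_apply, cf_T_lie_T _ _ _ _ _ _ (by simp), hr, hr]
    by_cases ha : a = 0
    · subst ha
      have := (hξ p q).1
      simp only [sub_zero, this, virMatrix, sub_self]
      simp
      ring
    · rw [h1 p q a ha]
      simp [virMatrix, ha]
  have hlbar (a : ℤ) : cf (.T p (q - a)) (.lbar a) ((g - d₀₁ ℂ B4c Wedge2 r₂) (T p q)) = 0 := by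
    rw [LinearMap.sub_apply, map_sub, d₀₁_apply, cf_T_lie_T _ _ _ _ _ _ (by simp), hr, hr]
    by_cases ha : a = 0
    · subst ha
      have := (hξ p q).2
      simp only [sub_zero, this, virMatrix, sub_self]
      simp
      ring
    · rw [h2 p q a ha]
      simp [virMatrix, ha]
  by_cases hw : weight i + weight j = weight (.T p q)
  · rcases weight_add_eq_weight_T hi hj hw with ⟨a, rfl, rfl⟩ | ⟨a, rfl, rfl⟩ | ⟨a, rfl, rfl⟩ |
      ⟨a, rfl, rfl⟩
    · exact hl a
    · exact hlbar a
    · rw [cf_swap, hl, neg_zero]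
    · rw [cf_swap, hlbar, neg_zero]
  · exact hk.cf_eq_zero hw

/-! ### The central components on the supertranslations -/

/-- Central elements are annihilated, so a pulled-back functional never involves their coordinates.
A zero functional is written as `0` times an arbitrary noncentral coordinate. -/
theorem coad_l_noncentral (m : ℤ) (i : Gen) :
    ∃ (t : ℂ) (j : Gen), Noncentral j ∧ coad (l m) i = t • basis.coord j := by
  cases i with
  | l a => exact ⟨_, .l (a - m), ⟨by simp, by simp⟩, coad_l_l m a⟩
  | lbar a => exact ⟨0, .l 0, ⟨by simp, by simp⟩, by rw [coad_l_lbar, zero_smul]⟩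
  | T p q => exact ⟨_, .T (p - m) q, ⟨by simp, by simp⟩, coad_l_T m p q⟩
  | c => exact ⟨_, .l (-m), ⟨by simp, by simp⟩, coad_l_c m⟩
  | cbar => exact ⟨0, .l 0, ⟨by simp, by simp⟩, by rw [coad_l_cbar, zero_smul]⟩

theorem coad_lbar_noncentral (m : ℤ) (i : Gen) :
    ∃ (t : ℂ) (j : Gen), Noncentral j ∧ coad (lbar m) i = t • basis.coord j := by
  cases i with
  | l a => exact ⟨0, .l 0, ⟨by simp, by simp⟩, by rw [coad_lbar_l, zero_smul]⟩
  | lbar a => exact ⟨_, .lbar (a - m), ⟨by simp, by simp⟩, coad_lbar_lbar m a⟩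
  | T p q => exact ⟨_, .T p (q - m), ⟨by simp, by simp⟩, coad_lbar_T m p q⟩
  | c => exact ⟨0, .l 0, ⟨by simp, by simp⟩, by rw [coad_lbar_c, zero_smul]⟩
  | cbar => exact ⟨_, .lbar (-m), ⟨by simp, by simp⟩, coad_lbar_cbar m⟩

theorem noncentral_T (p q : ℤ) : Noncentral (.T p q) := ⟨by simp, by simp⟩

section Central

variable {f : B4c →ₗ[ℂ] Wedge2} (hf : f ∈ Z1 ℂ B4c Wedge2)
  (hnc : ∀ p q i j, Noncentral i → Noncentral j → cf i j (f (T p q)) = 0)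
  {z : Gen} (hz : ∀ u v, z ≠ .T u v)
include hf hnc hz

/-- Every term of the cocycle identity for `l_m` and `T_{pq}` carries the factor `(m + 1)/2 - p`,
nonzero by `hp`; `hm` excludes an `l̄_0` contribution. -/
theorem cf_T_central_add_left {m p : ℤ} (q : ℤ) (hm : m ≠ 0) (hp : m + 1 ≠ 2 * p) :
    cf (.T (m + p) q) z (f (T (m + p) q)) =
      cf (.T p q) z (f (T p q)) + cf (.l m) z (f (l m)) := by
  have h := congrArg (cf (.T (m + p) q) z) (mem_Z1_iff.mp hf (l m) (T p q))
  obtain ⟨t, j, hj, ht⟩ := coad_l_noncentral m z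
  rw [lie_l_T, map_smul, map_smul, map_sub, cf_T_lie_T _ _ _ _ _ _ hz, cf_lie, coad_l_T, ht,
    pair_smul_left, pair_smul_right, pair_coord, pair_coord, hnc p q _ _ (noncentral_T _ _) hj,
    if_pos rfl, if_neg (by omega), add_sub_cancel_left, add_sub_cancel_right, smul_eq_mul] at h
  have h0 : ((m : ℂ) + 1) / 2 - p ≠ 0 := by
    intro h0
    apply hp
    have : ((m + 1 : ℤ) : ℂ) = ((2 * p : ℤ) : ℂ) := by
      push_cast
      linear_combination 2 * h0
    exact_mod_cast this
  apply mul_left_cancel₀ h0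
  push_cast at h
  linear_combination h

theorem cf_T_central_add_right {m q : ℤ} (p : ℤ) (hm : m ≠ 0) (hq : m + 1 ≠ 2 * q) :
    cf (.T p (q + m)) z (f (T p (q + m))) =
      cf (.T p q) z (f (T p q)) + cf (.lbar m) z (f (lbar m)) := by
  have h := congrArg (cf (.T p (q + m)) z) (mem_Z1_iff.mp hf (lbar m) (T p q))
  obtain ⟨t, j, hj, ht⟩ := coad_lbar_noncentral m z
  rw [lie_lbar_T, map_smul, map_smul, map_sub, cf_T_lie_T _ _ _ _ _ _ hz, cf_lie, coad_lbar_T, ht,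
    pair_smul_left, pair_smul_right, pair_coord, pair_coord, hnc p q _ _ (noncentral_T _ _) hj,
    if_neg (by omega), if_pos rfl, add_sub_cancel_left, add_sub_cancel_right, smul_eq_mul] at h
  have h0 : ((m : ℂ) + 1) / 2 - q ≠ 0 := by
    intro h0
    apply hq
    have : ((m + 1 : ℤ) : ℂ) = ((2 * q : ℤ) : ℂ) := by
      push_cast
      linear_combination 2 * h0
    exact_mod_cast this
  apply mul_left_cancel₀ h0
  push_cast at h
  linear_combination h

theorem cf_T_central_const (h1 : cf (.l 1) z (f (l 1)) = 0)
    (h2 : cf (.lbar 1) z (f (lbar 1)) = 0) (p q : ℤ) :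
    cf (.T p q) z (f (T p q)) = cf (.T 0 0) z (f (T 0 0)) := by
  have hl (p q : ℤ) : cf (.T (p + 1) q) z (f (T (p + 1) q)) = cf (.T p q) z (f (T p q)) := by
    have step (p : ℤ) (hp : p ≠ 1) :
        cf (.T (p + 1) q) z (f (T (p + 1) q)) = cf (.T p q) z (f (T p q)) := by
      have := cf_T_central_add_left hf hnc hz (m := 1) (p := p) q one_ne_zero (by omega)
      rwa [h1, add_zero, add_comm 1 p] at this
    -- At `p = 1` the factor for `l_1` vanishes. The steps `1 → 3` and `5 → 7` by `l_2` have equal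
    -- increments, and the latter is a sum of two unit steps already known to be trivial.
    by_cases hp : p = 1
    · subst hp
      have e1 := cf_T_central_add_left hf hnc hz (m := 2) (p := 5) q two_ne_zero (by omega)
      have e2 := cf_T_central_add_left hf hnc hz (m := 2) (p := 1) q two_ne_zero (by omega)
      have e3 := step 5 (by omega)
      have e4 := step 6 (by omega)
      have e5 := step 2 (by omega)
      norm_num at e1 e2 e3 e4 e5 ⊢
      linear_combination e2 - e5 - e1 + e4 + e3
    · exact step p hp
  have hr (p q : ℤ) : cf (.T p (q + 1)) z (f (T p (q + 1))) = cf (.T p q) z (f (T p q)) := by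
    have step (q : ℤ) (hq : q ≠ 1) :
        cf (.T p (q + 1)) z (f (T p (q + 1))) = cf (.T p q) z (f (T p q)) := by
      have := cf_T_central_add_right hf hnc hz (m := 1) (q := q) p one_ne_zero (by omega)
      rwa [h2, add_zero] at this
    by_cases hq : q = 1
    · subst hq
      have e1 := cf_T_central_add_right hf hnc hz (m := 2) (q := 5) p two_ne_zero (by omega)
      have e2 := cf_T_central_add_right hf hnc hz (m := 2) (q := 1) p two_ne_zero (by omega)
      have e3 := step 5 (by omega)
      have e4 := step 6 (by omega)
      have e5 := step 2 (by omega)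
      norm_num at e1 e2 e3 e4 e5 ⊢
      linear_combination e2 - e5 - e1 + e4 + e3
    · exact step q hq
  have hp (p : ℤ) : cf (.T p q) z (f (T p q)) = cf (.T 0 q) z (f (T 0 q)) := by
    induction p with
    | zero => rfl
    | succ n ih => rw [hl, ih]
    | pred n ih => rw [← ih, ← hl (-n - 1), sub_add_cancel]
  have hq (q : ℤ) : cf (.T 0 q) z (f (T 0 q)) = cf (.T 0 0) z (f (T 0 0)) := by
    induction q with
    | zero => rfl
    | succ n ih => rw [hr, ih]
    | pred n ih => rw [← ih, ← hr 0 (-n - 1), sub_add_cancel]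
  rw [hp, hq]

end Central

theorem cf_wedge_central (x : B4c) (s t : ℂ) {i j : Gen} (hi : Noncentral i)
    (hj : Noncentral j) : cf i j (wedge x (s • c + t • cbar)) = 0 := by
  rw [cf, pair_wedge]
  simp [c, cbar, hi.1.symm, hi.2.symm, hj.1.symm, hj.2.symm]

theorem lie_wedge_central (x y : B4c) (s t : ℂ) :
    ⁅x, wedge (R := ℂ) y (s • c + t • cbar)⁆ = wedge ⁅x, y⁆ (s • c + t • cbar) := by
  rw [lie_wedge, lie_central]
  simpa using wedge_smul_right (0 : ℂ) y 0

theorem wedge_zero_left (x : B4c) : wedge (R := ℂ) 0 x = 0 := by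
  simpa using wedge_smul_left (0 : ℂ) 0 x

theorem eq_T_of_weight_eq {i : Gen} {p q : ℤ} (h : weight i = weight (.T p q)) : i = .T p q := by
  cases i <;> simp only [weight] at h
  case T u v =>
    have := half_int_add_I_eq_zero (x := 2 * p - 2 * u) (y := 2 * q - 2 * v)
      (by push_cast; linear_combination h)
    obtain rfl : u = p := by omega
    obtain rfl : v = q := by omega
    rfl
  case l a =>
    have := half_int_add_I_eq_zero (x := 2 * p - 2 * a - 1) (y := 2 * q - 1)
      (by push_cast; linear_combination h)
    omega
  case lbar a =>
    have := half_int_add_I_eq_zero (x := 2 * p - 1) (y := 2 * q - 2 * a - 1)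
      (by push_cast; linear_combination h)
    omega
  all_goals
    have := half_int_add_I_eq_zero (x := 2 * p - 1) (y := 2 * q - 1)
      (by push_cast; linear_combination h)
    omega

theorem Homogeneous.sub {f g : B4c →ₗ[ℂ] Wedge2} (hf : Homogeneous f) (hg : Homogeneous g) :
    Homogeneous (f - g) := fun x => by
  rw [LinearMap.sub_apply, LinearMap.sub_apply, hf x, hg x, lie_sub]

theorem homogeneous_delta (α αbar : ℂ) : Homogeneous (delta α αbar) := by
  have h0 : delta α αbar gradingElt = 0 := by
    rw [gradingElt, map_add, map_smul, l, lbar, delta_basis, delta_basis]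
    simp [deltaGen]
  intro x
  rw [mem_Z1_iff.mp (delta_mem_Z1 α αbar), h0, lie_zero, sub_zero]

theorem exists_sub_eq_delta_on_T {f : B4c →ₗ[ℂ] Wedge2} (hf : f ∈ Z1 ℂ B4c Wedge2)
    (hh : Homogeneous f)
    (hnc : ∀ p q i j, Noncentral i → Noncentral j → cf i j (f (T p q)) = 0) :
    ∃ r α αbar, Homogeneous (f - d₀₁ ℂ B4c Wedge2 r - delta α αbar) ∧
      ∀ p q, (f - d₀₁ ℂ B4c Wedge2 r - delta α αbar) (T p q) = 0 := by
  -- Since `[l_1, l_0] = l_1` and `[l̄_1, l̄_0] = l̄_1`, this bivector cancels the components `l_1 ∧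
  -- central` of `f(l_1)` and `l̄_1 ∧ central` of `f(l̄_1)`.
  let r : Wedge2 :=
    wedge (l 0) (cf (.l 1) .c (f (l 1)) • c + cf (.l 1) .cbar (f (l 1)) • cbar) +
    wedge (lbar 0) (cf (.lbar 1) .c (f (lbar 1)) • c + cf (.lbar 1) .cbar (f (lbar 1)) • cbar)
  have hr : ⁅gradingElt, r⁆ = 0 := by
    have h1 : ⁅gradingElt, l 0⁆ = 0 := by rw [l, gradingElt_lie_basis]; simp [weight]
    have h2 : ⁅gradingElt, lbar 0⁆ = 0 := by rw [lbar, gradingElt_lie_basis]; simp [weight]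
    rw [lie_add, lie_wedge_central, lie_wedge_central, h1, h2, wedge_zero_left, wedge_zero_left,
      add_zero]
  have hg := hh.sub_d₀₁ hr
  have hgZ := sub_mem hf (d₀₁_mem_Z1 r)
  have hgnc : ∀ p q i j, Noncentral i → Noncentral j →
      cf i j ((f - d₀₁ ℂ B4c Wedge2 r) (T p q)) = 0 := by
    intro p q i j hi hj
    rw [LinearMap.sub_apply, map_sub, hnc p q i j hi hj, d₀₁_apply, lie_add, lie_wedge_central,
      lie_wedge_central, map_add, cf_wedge_central _ _ _ hi hj, cf_wedge_central _ _ _ hi hj]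
    simp
  have hl1 : ⁅l 1, r⁆ =
      wedge (l 1) (cf (.l 1) .c (f (l 1)) • c + cf (.l 1) .cbar (f (l 1)) • cbar) := by
    rw [lie_add, lie_wedge_central, lie_wedge_central, lie_l_lbar, wedge_zero_left, lie_l_l]
    simp [central]
  have hlbar1 : ⁅lbar 1, r⁆ = wedge (lbar 1)
      (cf (.lbar 1) .c (f (lbar 1)) • c + cf (.lbar 1) .cbar (f (lbar 1)) • cbar) := by
    have h0 : ⁅lbar 1, l 0⁆ = 0 := by rw [← lie_skew, lie_l_lbar, neg_zero]
    rw [lie_add, lie_wedge_central, lie_wedge_central, h0, wedge_zero_left, lie_lbar_lbar]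
    simp [central]
  set g := f - d₀₁ ℂ B4c Wedge2 r with hgdef
  have h1 : cf (.l 1) .c (g (l 1)) = 0 := by
    rw [hgdef, LinearMap.sub_apply, map_sub, d₀₁_apply, hl1, cf, pair_wedge]
    simp [l, c, cbar]
  have h2 : cf (.l 1) .cbar (g (l 1)) = 0 := by
    rw [hgdef, LinearMap.sub_apply, map_sub, d₀₁_apply, hl1, cf, pair_wedge]
    simp [l, c, cbar]
  have h3 : cf (.lbar 1) .c (g (lbar 1)) = 0 := by
    rw [hgdef, LinearMap.sub_apply, map_sub, d₀₁_apply, hlbar1, cf, pair_wedge]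
    simp [lbar, c, cbar]
  have h4 : cf (.lbar 1) .cbar (g (lbar 1)) = 0 := by
    rw [hgdef, LinearMap.sub_apply, map_sub, d₀₁_apply, hlbar1, cf, pair_wedge]
    simp [lbar, c, cbar]
  -- The sign appears because `delta` has the central factor on the left.
  let α := -cf (.T 0 0) .c (g (T 0 0))
  let αbar := -cf (.T 0 0) .cbar (g (T 0 0))
  have hk : Homogeneous (g - delta α αbar) := hg.sub (homogeneous_delta α αbar)
  refine ⟨r, α, αbar, hk, fun p q => ?_⟩
  have hc : cf (.T p q) .c ((g - delta α αbar) (T p q)) = 0 := by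
    rw [LinearMap.sub_apply, map_sub, cf_delta_T,
      cf_T_central_const hgZ hgnc (by simp) h1 h3 p q]
    simp [T, c, cbar, α]
  have hcbar : cf (.T p q) .cbar ((g - delta α αbar) (T p q)) = 0 := by
    rw [LinearMap.sub_apply, map_sub, cf_delta_T,
      cf_T_central_const hgZ hgnc (by simp) h2 h4 p q]
    simp [T, c, cbar, αbar]
  have hright (i z : Gen) (hz : z = .c ∨ z = .cbar) :
      cf i z ((g - delta α αbar) (T p q)) = 0 := by
    by_cases hw : weight i = weight (.T p q)
    · rw [eq_T_of_weight_eq hw]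
      rcases hz with rfl | rfl
      · exact hc
      · exact hcbar
    · refine hk.cf_eq_zero ?_
      have hwz : weight z = 0 := by rcases hz with rfl | rfl <;> rfl
      rwa [hwz, add_zero]
  refine cf_ext fun i j => ?_
  rw [map_zero]
  by_cases hj : Noncentral j
  · by_cases hi : Noncentral i
    · rw [LinearMap.sub_apply, map_sub, hgnc p q i j hi hj, cf_delta_T]
      simp [c, cbar, hi.1.symm, hi.2.symm, hj.1.symm, hj.2.symm]
    · rw [cf_swap, hright j i (by unfold Noncentral at hi; tauto), neg_zero]
  · exact hright i j (by unfold Noncentral at hj; tauto)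

/-! ### The action of `l_2` on pairs of supertranslations -/

/-- The operator by which `l_2` acts on the coefficients of `∑ φ(p, p') T_{pq} ⊗ T_{p'q'}`. -/
def pairShift : (ℤ × ℤ →₀ ℂ) →ₗ[ℂ] (ℤ × ℤ →₀ ℂ) :=
  Finsupp.lsum ℂ fun x : ℤ × ℤ =>
    (3 / 2 - (x.1 : ℂ)) • Finsupp.lsingle (x.1 + 2, x.2) +
      (3 / 2 - (x.2 : ℂ)) • Finsupp.lsingle (x.1, x.2 + 2)

theorem pairShift_apply (φ : ℤ × ℤ →₀ ℂ) (p p' : ℤ) :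
    pairShift φ (p, p') =
      (7 / 2 - (p : ℂ)) * φ (p - 2, p') + (7 / 2 - (p' : ℂ)) * φ (p, p' - 2) := by
  classical
  have : Finsupp.lapply (p, p') ∘ₗ pairShift =
      (7 / 2 - (p : ℂ)) • Finsupp.lapply (p - 2, p') +
        (7 / 2 - (p' : ℂ)) • (Finsupp.lapply (p, p' - 2) : (ℤ × ℤ →₀ ℂ) →ₗ[ℂ] ℂ) := by
    ext ⟨u, v⟩
    simp only [pairShift, LinearMap.comp_apply, Finsupp.lsingle_apply, Finsupp.lsum_single,
      LinearMap.add_apply, LinearMap.smul_apply, Finsupp.lapply_apply, Finsupp.add_apply,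
      Finsupp.smul_apply, Finsupp.single_apply, Prod.mk.injEq, smul_eq_mul]
    congr 1
    · by_cases h : u + 2 = p ∧ v = p'
      · obtain ⟨rfl, rfl⟩ := h
        simp
        ring
      · rw [if_neg h, if_neg (by omega), mul_zero, mul_zero]
    · by_cases h : u = p ∧ v + 2 = p'
      · obtain ⟨rfl, rfl⟩ := h
        simp
        ring
      · rw [if_neg h, if_neg (by omega), mul_zero, mul_zero]
  exact LinearMap.congr_fun this φ

/-- A support point with maximal first coordinate `p` yields a term with factor `3/2 - p` that
nothing cancels. The index 2 matters: for odd `m` the factor `(m + 1)/2 - p` has an integral zero.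
Values in a general `X` allow use modulo the image of another operator. -/
theorem eq_zero_of_shift_eq_zero {X : Type*} [AddCommGroup X] [Module ℂ X] {φ : ℤ × ℤ → X}
    (hfin : {x | φ x ≠ 0}.Finite)
    (h : ∀ p p' : ℤ, (7 / 2 - (p : ℂ)) • φ (p - 2, p') + (7 / 2 - (p' : ℂ)) • φ (p, p' - 2) = 0) :
    φ = 0 := by
  by_contra hne
  obtain ⟨y, hy⟩ := Function.ne_iff.mp hne
  obtain ⟨⟨p, p'⟩, hx, hmax⟩ := Set.exists_max_image _ Prod.fst hfin ⟨y, hy⟩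
  have h1 := h (p + 2) p'
  have h2 : φ (p + 2, p' - 2) = 0 := by
    by_contra h2
    have := hmax _ h2
    simp at this
  rw [h2, smul_zero, add_zero, add_sub_cancel_right] at h1
  rcases smul_eq_zero.mp h1 with h3 | h3
  · have : ((3 - 2 * p : ℤ) : ℂ) = 0 := by
      push_cast at h3 ⊢
      linear_combination 2 * h3
    have := Int.cast_eq_zero.mp this
    omega
  · exact hx h3

theorem pairShift_injective : Function.Injective pairShift := by
  rw [← LinearMap.ker_eq_bot, LinearMap.ker_eq_bot']
  intro φ hφ
  have : (φ : ℤ × ℤ → ℂ) = 0 := eq_zero_of_shift_eq_zero φ.hasFiniteSupport fun p p' => by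
    rw [smul_eq_mul, smul_eq_mul, ← pairShift_apply, hφ, Finsupp.zero_apply]
  exact DFunLike.coe_injective this

theorem cf_T_T_lie_l (m p q p' q' : ℤ) (w : Wedge2) :
    cf (.T p q) (.T p' q') ⁅l m, w⁆ =
      (((m : ℂ) + 1) / 2 - (p - m)) * cf (.T (p - m) q) (.T p' q') w +
      (((m : ℂ) + 1) / 2 - (p' - m)) * cf (.T p q) (.T (p' - m) q') w := by
  simp only [cf_lie, coad_l_T, pair_smul_left, pair_smul_right, pair_coord]

theorem cf_T_T_lie_lbar (m p q p' q' : ℤ) (w : Wedge2) :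
    cf (.T p q) (.T p' q') ⁅lbar m, w⁆ =
      (((m : ℂ) + 1) / 2 - (q - m)) * cf (.T p (q - m)) (.T p' q') w +
      (((m : ℂ) + 1) / 2 - (q' - m)) * cf (.T p q) (.T p' (q' - m)) w := by
  simp only [cf_lie, coad_lbar_T, pair_smul_left, pair_smul_right, pair_coord]

/-- The bivectors that are combinations of the `T_{pq} ∧ T_{rs}`. -/
def TranslationPart (w : Wedge2) : Prop :=
  ∀ i j, (∀ p q, i ≠ .T p q) → cf i j w = 0

theorem TranslationPart.ext {w : Wedge2} (hw : TranslationPart w)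
    (h : ∀ p q p' q', cf (.T p q) (.T p' q') w = 0) : w = 0 := by
  refine cf_ext fun i j => ?_
  rw [map_zero]
  by_cases hi : ∃ p q, i = .T p q
  · by_cases hj : ∃ p q, j = .T p q
    · obtain ⟨p, q, rfl⟩ := hi
      obtain ⟨p', q', rfl⟩ := hj
      exact h p q p' q'
    · push Not at hj
      rw [cf_swap, hw j i hj, neg_zero]
  · push Not at hi
    exact hw i j hi

theorem TranslationPart.eq_zero_of_lie_l {w : Wedge2} (hw : TranslationPart w)
    (h : ⁅l 2, w⁆ = 0) : w = 0 := by
  refine hw.ext fun p q p' q' => ?_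
  have : (fun x : ℤ × ℤ => cf (.T x.1 q) (.T x.2 q') w) = 0 := by
    refine eq_zero_of_shift_eq_zero ?_ fun p p' => ?_
    · exact finite_cf_ne_zero_comp (fun x : ℤ × ℤ => (.T x.1 q, .T x.2 q'))
        (fun x y h => by simpa [Prod.ext_iff] using h) w
    · have := cf_T_T_lie_l 2 p q p' q' w
      rw [h, map_zero] at this
      simp only [smul_eq_mul]
      push_cast at this
      linear_combination -this
  exact congrFun this (p, p')

theorem TranslationPart.eq_zero_of_lie_lbar {w : Wedge2} (hw : TranslationPart w)
    (h : ⁅lbar 2, w⁆ = 0) : w = 0 := by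
  refine hw.ext fun p q p' q' => ?_
  have : (fun x : ℤ × ℤ => cf (.T p x.1) (.T p' x.2) w) = 0 := by
    refine eq_zero_of_shift_eq_zero ?_ fun q q' => ?_
    · exact finite_cf_ne_zero_comp (fun x : ℤ × ℤ => (.T p x.1, .T p' x.2))
        (fun x y h => by simpa [Prod.ext_iff] using h) w
    · have := cf_T_T_lie_lbar 2 p q p' q' w
      rw [h, map_zero] at this
      simp only [smul_eq_mul]
      push_cast at this
      linear_combination -this
  exact congrFun this (q, q')

theorem TranslationPart.lie_l {w : Wedge2} (hw : TranslationPart w) (m : ℤ) :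
    TranslationPart ⁅l m, w⁆ := by
  intro i j hi
  have hzero (t : Gen) : cf i t w = 0 := hw i t hi
  have h1 : pair (coad (l m) i) (basis.coord j) w = 0 := by
    cases i with
    | T p q => exact absurd rfl (hi p q)
    | l a => rw [coad_l_l, pair_smul_left, pair_coord, hw _ _ (by simp), mul_zero]
    | lbar a => rw [coad_l_lbar, pair_zero_left]
    | c => rw [coad_l_c, pair_smul_left, pair_coord, hw _ _ (by simp), mul_zero]
    | cbar => rw [coad_l_cbar, pair_zero_left]
  obtain ⟨t, k, -, hk⟩ := coad_l_noncentral m j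
  rw [cf_lie, h1, hk, pair_smul_right, pair_coord, hzero, mul_zero, add_zero]

theorem TranslationPart.lie_lbar {w : Wedge2} (hw : TranslationPart w) (m : ℤ) :
    TranslationPart ⁅lbar m, w⁆ := by
  intro i j hi
  have hzero (t : Gen) : cf i t w = 0 := hw i t hi
  have h1 : pair (coad (lbar m) i) (basis.coord j) w = 0 := by
    cases i with
    | T p q => exact absurd rfl (hi p q)
    | l a => rw [coad_lbar_l, pair_zero_left]
    | lbar a => rw [coad_lbar_lbar, pair_smul_left, pair_coord, hw _ _ (by simp), mul_zero]
    | c => rw [coad_lbar_c, pair_zero_left]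
    | cbar => rw [coad_lbar_cbar, pair_smul_left, pair_coord, hw _ _ (by simp), mul_zero]
  obtain ⟨t, k, -, hk⟩ := coad_lbar_noncentral m j
  rw [cf_lie, h1, hk, pair_smul_right, pair_coord, hzero, mul_zero, add_zero]

theorem TranslationPart.lie_T {w : Wedge2} (hw : TranslationPart w) (p q : ℤ) :
    ⁅T p q, w⁆ = 0 := by
  have h1 (i j : Gen) : pair (coad (T p q) i) (basis.coord j) w = 0 := by
    cases i with
    | T u v =>
      rw [coad_T_T, pair_add_left, pair_smul_left, pair_smul_left, pair_coord, pair_coord,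
        hw _ _ (by simp), hw _ _ (by simp), mul_zero, mul_zero, add_zero]
    | l a => rw [coad_T_l, pair_zero_left]
    | lbar a => rw [coad_T_lbar, pair_zero_left]
    | c => rw [coad_T_c, pair_zero_left]
    | cbar => rw [coad_T_cbar, pair_zero_left]
  refine cf_ext fun i j => ?_
  rw [cf_lie, h1, pair_swap, h1, map_zero, neg_zero, add_zero]

theorem TranslationPart.sub {w w' : Wedge2} (hw : TranslationPart w) (hw' : TranslationPart w') :
    TranslationPart (w - w') := fun i j hi => by
  rw [map_sub, hw i j hi, hw' i j hi, sub_zero]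

/-- The label of `T_{pq} ∧ T_{p'q'}`, as a function of `((q, q'), (p, p'))`. -/
def translationPair (x : (ℤ × ℤ) × (ℤ × ℤ)) : Gen × Gen :=
  (.T x.2.1 x.1.1, .T x.2.2 x.1.2)

theorem translationPair_injective : Function.Injective translationPair := by
  rintro ⟨⟨q, q'⟩, ⟨p, p'⟩⟩ ⟨⟨s, s'⟩, ⟨r, r'⟩⟩ h
  simp only [translationPair, Prod.mk.injEq, Gen.T.injEq] at h ⊢
  tauto

/-- The coefficients of the `T_{pq} ∧ T_{p'q'}`, sorted by `(q, q')`. -/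
def translationCoeffs (w : Wedge2) : ℤ × ℤ →₀ (ℤ × ℤ →₀ ℂ) :=
  ((coeffs basis w).comapDomain translationPair translationPair_injective.injOn).curry

theorem translationCoeffs_apply (w : Wedge2) (p q p' q' : ℤ) :
    translationCoeffs w (q, q') (p, p') = cf (.T p q) (.T p' q') w := by
  rw [translationCoeffs, Finsupp.curry_apply, Finsupp.comapDomain_apply, translationPair,
    coeffs_apply]
  rfl

theorem exists_translationPart (ρ : ℤ × ℤ →₀ (ℤ × ℤ →₀ ℂ)) :
    ∃ r : Wedge2, TranslationPart r ∧ ∀ p q p' q', cf (.T p q) (.T p' q') r =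
      (ρ (q, q') (p, p') - ρ (q', q) (p', p)) / 2 := by
  let G := Finsupp.mapDomain translationPair ρ.uncurry
  have hG (p q p' q' : ℤ) : G (.T p q, .T p' q') = ρ (q, q') (p, p') :=
    Finsupp.mapDomain_apply translationPair_injective ρ.uncurry ((q, q'), (p, p'))
  have hG1 (i j : Gen) (hi : ∀ p q, i ≠ .T p q) : G (i, j) = 0 :=
    Finsupp.mapDomain_of_notMem_range _ _ (by
      rintro ⟨x, hx⟩
      exact hi _ _ (congrArg Prod.fst hx).symm)
  have hG2 (i j : Gen) (hi : ∀ p q, i ≠ .T p q) : G (j, i) = 0 :=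
    Finsupp.mapDomain_of_notMem_range _ _ (by
      rintro ⟨x, hx⟩
      exact hi _ _ (congrArg Prod.snd hx).symm)
  refine ⟨(2⁻¹ : ℂ) • ofCoeffs basis G, fun i j hi => ?_, fun p q p' q' => ?_⟩
  · rw [map_smul, cf, pair_ofCoeffs, hG1 i j hi, hG2 i j hi, sub_zero, smul_zero]
  · rw [map_smul, cf, pair_ofCoeffs, hG, hG, smul_eq_mul]
    ring

/-- If `l_2 ▹ w₂ = l̄_2 ▹ w₁`, then `w₁ = l_2 ▹ r` for some `r`. -/
theorem exists_lie_l_eq {w₁ w₂ : Wedge2} (hw₁ : TranslationPart w₁)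
    (h : ⁅l 2, w₂⁆ = ⁅lbar 2, w₁⁆) : ∃ r, TranslationPart r ∧ ⁅l 2, r⁆ = w₁ := by
  obtain ⟨inv, hinv⟩ := LinearMap.exists_leftInverse_of_injective pairShift
    (LinearMap.ker_eq_bot.mpr pairShift_injective)
  have hinv' (φ : ℤ × ℤ →₀ ℂ) : inv (pairShift φ) = φ := LinearMap.congr_fun hinv φ
  -- `Q` kills exactly the image of `pairShift`, so it tests whether a coefficient function in `(p,
  -- p')` comes from `l_2`.
  let Q : (ℤ × ℤ →₀ ℂ) →ₗ[ℂ] (ℤ × ℤ →₀ ℂ) := LinearMap.id - pairShift ∘ₗ inv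
  have hQ (φ : ℤ × ℤ →₀ ℂ) : Q (pairShift φ) = 0 := by
    simp [Q, hinv']
  have hrel (q q' : ℤ) : (7 / 2 - (q : ℂ)) • translationCoeffs w₁ (q - 2, q') +
      (7 / 2 - (q' : ℂ)) • translationCoeffs w₁ (q, q' - 2) =
        pairShift (translationCoeffs w₂ (q, q')) := by
    ext ⟨p, p'⟩
    have := congrArg (cf (.T p q) (.T p' q')) h
    rw [cf_T_T_lie_l, cf_T_T_lie_lbar] at this
    simp only [Finsupp.add_apply, Finsupp.smul_apply, pairShift_apply, translationCoeffs_apply,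
      smul_eq_mul]
    push_cast at this
    linear_combination -this
  -- By `hrel`, the `l̄_2`-shift of `Q`-values vanishes; finite support in `(q, q')` then forces
  -- these values to be zero.
  have hQ0 : (fun x => Q (translationCoeffs w₁ x)) = 0 := by
    refine eq_zero_of_shift_eq_zero ?_ fun q q' => ?_
    · refine (translationCoeffs w₁).hasFiniteSupport.subset fun x hx h0 => hx ?_
      simp only [h0, map_zero]
    · have := congrArg Q (hrel q q')
      rwa [map_add, map_smul, map_smul, hQ] at this
  have hsec (x : ℤ × ℤ) :
      pairShift (inv (translationCoeffs w₁ x)) = translationCoeffs w₁ x := by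
    have := congrFun hQ0 x
    exact (sub_eq_zero.mp this).symm
  -- The preimages given by `inv` need not be antisymmetric. Antisymmetrizing is harmless, because
  -- the action of `l_2` commutes with exchanging the two factors and `w₁` is already antisymmetric.
  obtain ⟨r, hr, hrc⟩ := exists_translationPart
    (Finsupp.mapRange.linearMap inv (translationCoeffs w₁))
  refine ⟨r, hr, sub_eq_zero.mp (((hr.lie_l 2).sub hw₁).ext fun p q p' q' => ?_)⟩
  have e1 := DFunLike.congr_fun (hsec (q, q')) (p, p')
  have e2 := DFunLike.congr_fun (hsec (q', q)) (p', p)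
  rw [pairShift_apply, translationCoeffs_apply] at e1 e2
  rw [map_sub, cf_T_T_lie_l, hrc, hrc]
  simp only [Finsupp.mapRange.linearMap_apply, Finsupp.mapRange_apply]
  rw [cf_swap (.T p' q')] at e2
  push_cast
  linear_combination (1 / 2 : ℂ) * e1 - (1 / 2 : ℂ) * e2

/-! ### Cocycles vanishing on the supertranslations -/

/-- The relevant coefficient is `p - (a + 1)/2` times the unknown, so the equations for `p = 0` and
`p = 1` differ by the unknown itself. For `a = 0` the additional barred term is the same in both and
cancels; the barred statement is symmetric. -/
theorem cf_eq_zero_of_lie_T_eq_zero {w : Wedge2} (h : ∀ p q, ⁅T p q, w⁆ = 0) {j : Gen}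
    (hj : ∀ p q, j ≠ .T p q) (a : ℤ) : cf (.l a) j w = 0 ∧ cf (.lbar a) j w = 0 := by
  constructor
  · have e0 := congrArg (cf (.T a 0) j) (h 0 0)
    have e1 := congrArg (cf (.T (1 + a) 0) j) (h 1 0)
    rw [cf_T_lie_T _ _ _ _ _ _ hj, map_zero] at e0 e1
    rw [if_pos rfl] at e0 e1
    by_cases ha : a = 0
    · subst ha
      norm_num at e0 e1 ⊢
      linear_combination e1 - e0
    · rw [if_neg (by omega)] at e0 e1
      simp only [sub_zero, add_sub_cancel_left] at e0 e1
      push_cast at e0 e1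
      linear_combination e1 - e0
  · have e0 := congrArg (cf (.T 0 a) j) (h 0 0)
    have e1 := congrArg (cf (.T 0 (1 + a)) j) (h 0 1)
    rw [cf_T_lie_T _ _ _ _ _ _ hj, map_zero] at e0 e1
    rw [if_pos (rfl : (0 : ℤ) = 0)] at e0 e1
    by_cases ha : a = 0
    · subst ha
      norm_num at e0 e1 ⊢
      linear_combination e1 - e0
    · rw [if_neg (by omega)] at e0 e1
      simp only [sub_zero, add_sub_cancel_left] at e0 e1
      push_cast at e0 e1
      linear_combination e1 - e0

theorem exists_weight_eq {i : Gen} (hi : ∀ p q, i ≠ .T p q) :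
    ∃ x y : ℤ, weight i = x + y * Complex.I := by
  cases i with
  | T p q => exact absurd rfl (hi p q)
  | l a => exact ⟨-a, 0, by simp [weight]⟩
  | lbar a => exact ⟨0, -a, by simp [weight]⟩
  | c => exact ⟨0, 0, by simp [weight]⟩
  | cbar => exact ⟨0, 0, by simp [weight]⟩

theorem weight_add_weight_T_ne {i k : Gen} (hi : ∀ p q, i ≠ .T p q) (hk : ∀ p q, k ≠ .T p q)
    (p q : ℤ) : weight i + weight (.T p q) ≠ weight k := by
  obtain ⟨x, y, hxy⟩ := exists_weight_eq hi
  obtain ⟨u, v, huv⟩ := exists_weight_eq hk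
  intro h
  rw [hxy, huv, weight] at h
  have := half_int_add_I_eq_zero (x := 2 * x + 1 - 2 * p - 2 * u)
    (y := 2 * y + 1 - 2 * q - 2 * v) (by push_cast; linear_combination h)
  omega

/-- Parity of weights excludes `T ∧ non-T`, annihilation by the `T_{pq}` excludes `l` and `l̄`, and
only `c ∧ c̄` is left to the hypothesis `hz`. -/
theorem translationPart_of_lie_T_eq_zero {f : B4c →ₗ[ℂ] Wedge2} (hh : Homogeneous f) {k : Gen}
    (hk : ∀ p q, k ≠ .T p q) (hT : ∀ p q, ⁅T p q, f (basis k)⁆ = 0)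
    (hz : cf .c .cbar (f (basis k)) = 0) : TranslationPart (f (basis k)) := by
  intro i j hi
  by_cases hj : ∃ p q, j = .T p q
  · obtain ⟨p, q, rfl⟩ := hj
    exact hh.cf_eq_zero (weight_add_weight_T_ne hi hk p q)
  · push Not at hj
    have hl (a : ℤ) {j : Gen} (hj : ∀ p q, j ≠ .T p q) := cf_eq_zero_of_lie_T_eq_zero hT hj a
    cases i with
    | T p q => exact absurd rfl (hi p q)
    | l a => exact (hl a hj).1
    | lbar a => exact (hl a hj).2
    | c =>
      cases j with
      | T p q => exact absurd rfl (hj p q)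
      | l a => rw [cf_swap, (hl a hi).1, neg_zero]
      | lbar a => rw [cf_swap, (hl a hi).2, neg_zero]
      | c => exact cf_self _ _
      | cbar => exact hz
    | cbar =>
      cases j with
      | T p q => exact absurd rfl (hj p q)
      | l a => rw [cf_swap, (hl a hi).1, neg_zero]
      | lbar a => rw [cf_swap, (hl a hi).2, neg_zero]
      | c => rw [cf_swap, hz, neg_zero]
      | cbar => exact cf_self _ _

section VanishingOnT

variable {f : B4c →ₗ[ℂ] Wedge2} (hf : f ∈ Z1 ℂ B4c Wedge2) (hT : ∀ p q, f (T p q) = 0)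
include hf hT

theorem lie_T_apply_l (m p q : ℤ) : ⁅T p q, f (l m)⁆ = 0 := by
  have h := mem_Z1_iff.mp hf (l m) (T p q)
  rwa [lie_l_T, map_smul, hT, hT, smul_zero, lie_zero, zero_sub, zero_eq_neg] at h

theorem lie_T_apply_lbar (m p q : ℤ) : ⁅T p q, f (lbar m)⁆ = 0 := by
  have h := mem_Z1_iff.mp hf (lbar m) (T p q)
  rwa [lie_lbar_T, map_smul, hT, hT, smul_zero, lie_zero, zero_sub, zero_eq_neg] at h

/-- The `c ∧ c̄` coefficient is invisible on the right of the cocycle identity, so it vanishes on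
brackets: `[l_m, l_0] = m l_m` for `m ≠ 0`, and `[l_1, l_{-1}] = 2 l_0`, where the central term is
zero. -/
theorem cf_c_cbar_apply_l (m : ℤ) : cf .c .cbar (f (l m)) = 0 := by
  have h0 (m n : ℤ) : cf .c .cbar ⁅l m, f (l n)⁆ = 0 := by
    rw [cf_lie, coad_l_c, coad_l_cbar, pair_zero_right, pair_smul_left, pair_coord,
      (cf_eq_zero_of_lie_T_eq_zero (lie_T_apply_l hf hT n) (by simp) _).1, mul_zero, add_zero]
  have h1 (m n : ℤ) := congrArg (cf .c .cbar) (mem_Z1_iff.mp hf (l m) (l n))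
  simp only [lie_l_l, map_add, map_smul, map_sub, h0, sub_zero, smul_eq_mul] at h1
  by_cases hm : m = 0
  · subst hm
    have := h1 1 (-1)
    simp [central] at this
    tauto
  · have := h1 m 0
    simpa [central, hm] using this

theorem cf_c_cbar_apply_lbar (m : ℤ) : cf .c .cbar (f (lbar m)) = 0 := by
  have h0 (m n : ℤ) : cf .c .cbar ⁅lbar m, f (lbar n)⁆ = 0 := by
    rw [cf_lie, coad_lbar_c, coad_lbar_cbar, pair_zero_left, pair_smul_right, pair_coord, cf_swap,
      (cf_eq_zero_of_lie_T_eq_zero (lie_T_apply_lbar hf hT n) (by simp) _).2, neg_zero, mul_zero,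
      add_zero]
  have h1 (m n : ℤ) := congrArg (cf .c .cbar) (mem_Z1_iff.mp hf (lbar m) (lbar n))
  simp only [lie_lbar_lbar, map_add, map_smul, map_sub, h0, sub_zero, smul_eq_mul] at h1
  by_cases hm : m = 0
  · subst hm
    have := h1 1 (-1)
    simp [central] at this
    tauto
  · have := h1 m 0
    simpa [central, hm] using this

theorem eq_zero_of_vanish (hl : ∀ m, f (l m) = 0) (hlbar : ∀ m, f (lbar m) = 0) : f = 0 := by
  have h_c : f c = 0 := by
    -- The smallest positive index at which `m³ - m` is nonzero.
    have h := mem_Z1_iff.mp hf (l 2) (l (-2))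
    rw [lie_l_l, map_add, map_smul, map_smul, hl, hl, hl, lie_zero, lie_zero, sub_zero, smul_zero,
      zero_add] at h
    refine (smul_eq_zero.mp h).resolve_left ?_
    norm_num [central]
  have h_cbar : f cbar = 0 := by
    have h := mem_Z1_iff.mp hf (lbar 2) (lbar (-2))
    rw [lie_lbar_lbar, map_add, map_smul, map_smul, hlbar, hlbar, hlbar, lie_zero, lie_zero,
      sub_zero, smul_zero, zero_add] at h
    refine (smul_eq_zero.mp h).resolve_left ?_
    norm_num [central]
  refine basis.ext fun i => ?_
  cases i with
  | l m => exact hl m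
  | lbar m => exact hlbar m
  | T p q => exact hT p q
  | c => exact h_c
  | cbar => exact h_cbar

theorem exists_eq_d₀₁ (hh : Homogeneous f) : ∃ r, f = d₀₁ ℂ B4c Wedge2 r := by
  have hl (m : ℤ) : TranslationPart (f (l m)) :=
    translationPart_of_lie_T_eq_zero hh (by simp) (lie_T_apply_l hf hT m)
      (cf_c_cbar_apply_l hf hT m)
  have hlbar (m : ℤ) : TranslationPart (f (lbar m)) :=
    translationPart_of_lie_T_eq_zero hh (by simp) (lie_T_apply_lbar hf hT m)
      (cf_c_cbar_apply_lbar hf hT m)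
  have hcomm {g : B4c →ₗ[ℂ] Wedge2} (hg : g ∈ Z1 ℂ B4c Wedge2) (m n : ℤ) :
      ⁅l m, g (lbar n)⁆ = ⁅lbar n, g (l m)⁆ := by
    have h := mem_Z1_iff.mp hg (l m) (lbar n)
    rw [lie_l_lbar, map_zero] at h
    exact sub_eq_zero.mp h.symm
  obtain ⟨r, hr, hr2⟩ := exists_lie_l_eq (hl 2) (hcomm hf 2 2)
  refine ⟨r, sub_eq_zero.mp ?_⟩
  have hgZ := sub_mem hf (d₀₁_mem_Z1 r)
  have hl' (m : ℤ) : TranslationPart ((f - d₀₁ ℂ B4c Wedge2 r) (l m)) := by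
    rw [LinearMap.sub_apply, d₀₁_apply]
    exact (hl m).sub (hr.lie_l m)
  have hlbar' (m : ℤ) : TranslationPart ((f - d₀₁ ℂ B4c Wedge2 r) (lbar m)) := by
    rw [LinearMap.sub_apply, d₀₁_apply]
    exact (hlbar m).sub (hr.lie_lbar m)
  have hT' (p q : ℤ) : (f - d₀₁ ℂ B4c Wedge2 r) (T p q) = 0 := by
    rw [LinearMap.sub_apply, d₀₁_apply, hT, hr.lie_T, sub_zero]
  have hl2 : (f - d₀₁ ℂ B4c Wedge2 r) (l 2) = 0 := by
    rw [LinearMap.sub_apply, d₀₁_apply, hr2, sub_self]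
  -- Commutation of `l` with `l̄` propagates the vanishing: from `l_2` to every `l̄_m` by
  -- injectivity of `l_2`, then back to every `l_m` by injectivity of `l̄_2`.
  have hlbar0 (m : ℤ) : (f - d₀₁ ℂ B4c Wedge2 r) (lbar m) = 0 :=
    (hlbar' m).eq_zero_of_lie_l (by rw [hcomm hgZ, hl2, lie_zero])
  have hl0 (m : ℤ) : (f - d₀₁ ℂ B4c Wedge2 r) (l m) = 0 :=
    (hl' m).eq_zero_of_lie_lbar (by rw [← hcomm hgZ, hlbar0, lie_zero])
  exact eq_zero_of_vanish hgZ hT' hl0 hlbar0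

end VanishingOnT

/-! ### Assembly of the reductions and the classification -/

theorem exists_sub_delta_eq_d₀₁ {f : B4c →ₗ[ℂ] Wedge2} (hf : f ∈ Z1 ℂ B4c Wedge2) :
    ∃ α αbar r, f - delta α αbar = d₀₁ ℂ B4c Wedge2 r := by
  obtain ⟨r₁, h₁⟩ := exists_homogeneous hf
  have hf₁ := sub_mem hf (d₀₁_mem_Z1 r₁)
  obtain ⟨r₂, h₂, hnc⟩ := exists_sub_noncentral hf₁ h₁
  have hf₂ := sub_mem hf₁ (d₀₁_mem_Z1 r₂)
  obtain ⟨r₃, α, αbar, h₃, hT⟩ := exists_sub_eq_delta_on_T hf₂ h₂ hnc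
  have hf₃ := sub_mem (sub_mem hf₂ (d₀₁_mem_Z1 r₃)) (delta_mem_Z1 α αbar)
  obtain ⟨r₄, h₄⟩ := exists_eq_d₀₁ hf₃ hT h₃
  refine ⟨α, αbar, r₁ + r₂ + r₃ + r₄, ?_⟩
  rw [map_add, map_add, map_add, ← h₄]
  abel

theorem delta_sub (α αbar β βbar : ℂ) :
    delta α αbar - delta β βbar = delta (α - β) (αbar - βbar) := by
  refine basis.ext fun i => ?_
  rw [LinearMap.sub_apply, delta_basis, delta_basis, delta_basis]
  cases i <;> simp only [deltaGen, sub_self]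
  rw [sub_eq_iff_eq_add, ← wedge_add_left]
  congr 1
  module

end BMS4c

end

theorem mainTheorem6 :
    ∃ hZ : ∀ α αbar : ℂ,
        BMS4c.delta α αbar ∈ LieCohomology.Z1 ℂ BMS4c.B4c (ExteriorSquare.ExtSq ℂ BMS4c.B4c),
      Function.Bijective (fun p : ℂ × ℂ =>
        (Submodule.Quotient.mk ⟨BMS4c.delta p.1 p.2, hZ p.1 p.2⟩ :
          LieCohomology.H1 ℂ BMS4c.B4c (ExteriorSquare.ExtSq ℂ BMS4c.B4c))) := by
  refine ⟨BMS4c.delta_mem_Z1, ?_, ?_⟩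
  · rintro ⟨α, αbar⟩ ⟨β, βbar⟩ h
    have h1 := (Submodule.Quotient.eq _).mp h
    obtain ⟨r, hr⟩ := Submodule.mem_comap.mp h1
    have h2 : BMS4c.delta (α - β) (αbar - βbar) = LieCohomology.d₀₁ ℂ _ _ r := by
      rw [← BMS4c.delta_sub, hr]
      rfl
    obtain ⟨h3, h4⟩ := BMS4c.delta_eq_d₀₁ h2
    rw [sub_eq_zero.mp h3, sub_eq_zero.mp h4]
  · intro x
    obtain ⟨⟨f, hf⟩, rfl⟩ := Submodule.Quotient.mk_surjective _ x
    obtain ⟨α, αbar, r, hr⟩ := BMS4c.exists_sub_delta_eq_d₀₁ hf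
    refine ⟨(α, αbar), ((Submodule.Quotient.eq _).mpr ?_).symm⟩
    exact Submodule.mem_comap.mpr ⟨r, hr.symm⟩
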